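/- Let $k\ge 3$ be an integer. For $n\ge 1$ and $p\in[0,1]$ let $[n]_p$ be the random subset of $[n]=\{1,\dots,n\}$ in which each element is included independently with probability $p$, and let $X=X_{k,n,p}$ be the number of arithmetic progressions of length $k$ in $[n]_p$, i.e. the number of $k$-element subsets $\{a,a+d,\dots,a+(k-1)d\}$ ($d\ge 1$) of $[n]$ that are contained in $[n]_p$; thus $X_{k,n,1}$ is the number of such progressions in $[n]$. Set $\mu=\mathbb{E}X$ and $$\Psi(t)=\min\Bigl\{\frac{t^2}{\operatorname{Var}X},\ \sqrt{t}\,\log(1/p)\Bigr\}.$$ Then there is $n_0>0$, depending only on $k$, such that for every $\gamma\in(0,1)$ there are constants $c,C>0$, depending only on $\gamma$ and $k$, for which the following holds: for all integers $n\ge n_0$, all $p$ with $(\log n)^{1/(k-1)}n^{-1/(k-1)}\le p\le 1-\gamma$ and all real $t\ge\sqrt{\operatorname{Var}X}$, $$\mathbf{1}_{\{\mu+t\le X_{k,n,1}\}}\exp\bigl(-C\,\Psi(t)\bigr)\ \le\ \mathbb{P}(X\ge\mu+t)\ \le\ \exp\bigl(-c\,\Psi(t)\bigr).$$ -/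

import Mathlib

open MeasureTheory ProbabilityTheory

/-- The finite set `f` of naturals is a (non-degenerate) arithmetic progression of length `k`,
i.e. `f = {a, a + d, …, a + (k - 1) d}` for some `a` and some common difference `d > 0`. -/
def IsArithProg (k : ℕ) (f : Finset ℕ) : Prop :=
  ∃ a d : ℕ, 0 < d ∧ f = (Finset.range k).image (fun i => a + i * d)

open Classical in
/-- The family of all `k`-subsets of `[n] = {1, …, n}` that form an arithmetic progression
of length `k`. -/
noncomputable def arithProgs (k n : ℕ) : Finset (Finset ℕ) :=
  (Finset.Icc 1 n).powerset.filter (IsArithProg k)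

open Classical in
/-- The number of arithmetic progressions of length `k` in `[n]` that are contained in `S`. -/
noncomputable def arithProgCount (k n : ℕ) (S : Set ℕ) : ℝ :=
  (((arithProgs k n).filter (fun f : Finset ℕ => (f : Set ℕ) ⊆ S)).card : ℝ)

/-- The law of the binomial random subset `[n]_p` of `[n] = {1, …, n}`: each element is included
independently with probability `p`. -/
noncomputable def randomSubset (n : ℕ) (p : unitInterval) : Measure (Set ℕ) :=
  setBernoulli (Set.Icc 1 n) p

/-- `μ = 𝔼 X`, where `X = X_{k,n,p}` is the number of arithmetic progressions of length `k`
in `[n]_p`. -/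
noncomputable def arithProgMean (k n : ℕ) (p : unitInterval) : ℝ :=
  ∫ S, arithProgCount k n S ∂(randomSubset n p)

/-- `Var X`, where `X = X_{k,n,p}`. -/
noncomputable def arithProgVar (k n : ℕ) (p : unitInterval) : ℝ :=
  variance (arithProgCount k n) (randomSubset n p)

/-- `Ψ(t) = min {t² / Var X, √t log (1/p)}`. -/
noncomputable def arithProgRate (k n : ℕ) (p : unitInterval) (t : ℝ) : ℝ :=
  min (t ^ 2 / arithProgVar k n p) (√t * Real.log (1 / (p : ℝ)))

/-! Write λ = log(1/p). When np^{k-1} ≥ 1, pairs of progressions sharing exactly one point govern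
the variance, so Var X has order n³p^{2k-1} up to constants depending on k and γ (`apVar_le`,
`le_apVar`).

Lower bound. Two strategies compete. Raising the density from p to p(1 + O(t/μ)) makes the deviation
typical and costs about np(t/μ)², which has order t²/Var X; this works for t ≤ cμ
(`tilting_lower_bound`). Planting an initial interval of length m of order √t creates order t
progressions and costs p^m (`planting_lower_bound`). Once t ≥ cμ, planting is the cheaper of the two
up to a constant (`sqrt_mul_log_le`).

Upper bound. Let L be a small multiple of the rate. If every point of the random set lay in
O(np^{k-1}) of its progressions, an excess of t would produce many ordered r-tuples of pairwise
disjoint progressions, with r of order t/(np^{k-1}). The expected number of such tuples is at most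
μ^r, so Markov's inequality suffices (`binProb_exists_sparse_le`). It remains to discard the
progressions through points of larger degree, and to show that they rarely number more than t/2.

Codegrees are bounded, so a point of large degree is the centre of a large star. Many disjoint stars
are unlikely (`binProb_hasStars_le`), and without them a small set B meets every star. The sum of
the degrees above a threshold y is then controlled by the degrees inside B, that is, by |B|y' plus
the sum of the degrees above a second threshold y' (`heavyDegree_le_of_not_hasStars`). Two such
steps reach a threshold that no degree attains. The parameters fit because of `mul_le_of_le_rate`:
t/L exceeds np^{k-1} by the factor p^{-1/6}, up to a constant, which gains a factor λ in the
exponent for each petal of the larger stars. -/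

open Finset in
/-- Expectation of `g` over the binomial random subset of `V`. -/
noncomputable def binExp (V : Finset ℕ) (p : ℝ) (g : Finset ℕ → ℝ) : ℝ :=
  ∑ A ∈ V.powerset, p ^ #A * (1 - p) ^ (#V - #A) * g A

open Classical in
/-- Probability of the event `P` for the binomial random subset of `V`. -/
noncomputable def binProb (V : Finset ℕ) (p : ℝ) (P : Finset ℕ → Prop) : ℝ :=
  binExp V p (fun A => if P A then 1 else 0)

/-! ### Finite binomial expectations and elementary tail inequalities -/

section BinExp

open Finset

variable {V : Finset ℕ} {p : ℝ} {g h : Finset ℕ → ℝ}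

lemma binExp_congr (H : ∀ A ⊆ V, g A = h A) : binExp V p g = binExp V p h :=
  Finset.sum_congr rfl fun A hA => by rw [H A (mem_powerset.1 hA)]

lemma binExp_add : binExp V p (fun A => g A + h A) = binExp V p g + binExp V p h := by
  simp [binExp, mul_add, Finset.sum_add_distrib]

lemma binExp_const_mul (c : ℝ) : binExp V p (fun A => c * g A) = c * binExp V p g := by
  simp only [binExp, Finset.mul_sum]
  exact Finset.sum_congr rfl fun A _ => by ring

lemma binExp_sum {ι : Type*} (s : Finset ι) (G : ι → Finset ℕ → ℝ) :
    binExp V p (fun A => ∑ i ∈ s, G i A) = ∑ i ∈ s, binExp V p (G i) := by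
  simp only [binExp, Finset.mul_sum]
  exact Finset.sum_comm

lemma binExp_const (c : ℝ) : binExp V p (fun _ => c) = c := by
  rw [binExp, ← Finset.sum_mul, Finset.sum_pow_mul_eq_add_pow]
  simp

lemma binExp_mono (hp0 : 0 ≤ p) (hp1 : p ≤ 1) (H : ∀ A ⊆ V, g A ≤ h A) :
    binExp V p g ≤ binExp V p h := by
  have : 0 ≤ 1 - p := by linarith
  exact Finset.sum_le_sum fun A hA =>
    mul_le_mul_of_nonneg_left (H A (mem_powerset.1 hA)) (by positivity)

lemma binExp_nonneg (hp0 : 0 ≤ p) (hp1 : p ≤ 1) (H : ∀ A ⊆ V, 0 ≤ g A) : 0 ≤ binExp V p g := by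
  simpa [binExp_const] using binExp_mono (g := fun _ => 0) hp0 hp1 H

lemma binExp_insert {v : ℕ} (hv : v ∉ V) :
    binExp (insert v V) p g = p * binExp V p (fun A => g (insert v A)) + (1 - p) * binExp V p g := by
  rw [binExp, Finset.sum_powerset_insert hv, add_comm, binExp, binExp, Finset.mul_sum,
    Finset.mul_sum]
  congr 1 <;> refine Finset.sum_congr rfl fun A hA => ?_
  · have hA' : v ∉ A := fun h => hv (mem_powerset.1 hA h)
    rw [card_insert_of_notMem hA', card_insert_of_notMem hv, Nat.add_sub_add_right]
    ring
  · have := card_le_card (mem_powerset.1 hA)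
    rw [card_insert_of_notMem hv, Nat.sub_add_comm this, pow_succ]
    ring

lemma binExp_superset {B : Finset ℕ} (hB : B ⊆ V) :
    binExp V p (fun A => if B ⊆ A then 1 else 0) = p ^ #B := by
  induction V using Finset.induction_on generalizing B with
  | empty => simp [binExp, subset_empty.1 hB]
  | insert v V hv ih =>
    rw [binExp_insert hv]
    by_cases hvB : v ∈ B
    · have h1 : binExp V p (fun A => if B ⊆ insert v A then 1 else 0) = p ^ #(B.erase v) := by
        rw [← ih (B := B.erase v) (by rwa [← subset_insert_iff])]
        exact binExp_congr fun A _ => by simp only [subset_insert_iff]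
      have h2 : binExp V p (fun A => if B ⊆ A then 1 else 0) = 0 := by
        refine (binExp_congr (h := fun _ => 0) fun A hA => if_neg ?_).trans (binExp_const 0)
        exact fun hBA => hv (hA (hBA hvB))
      rw [h1, h2, ← card_erase_add_one hvB]
      ring
    · have hBV : B ⊆ V := fun x hx =>
        (mem_insert.1 (hB hx)).resolve_left fun h => hvB (h ▸ hx)
      have h1 : binExp V p (fun A => if B ⊆ insert v A then 1 else 0) = p ^ #B := by
        rw [← ih hBV]
        exact binExp_congr fun A _ => by simp only [subset_insert_iff_of_notMem hvB]
      rw [h1, ih hBV]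
      ring

/-- Conditioning on the event I ⊆ A, of probability p^#I, turns A into A ∪ I. This is the price of
planting I. -/
lemma pow_mul_binExp_union_le (hp0 : 0 ≤ p) (hp1 : p ≤ 1) (hg : ∀ A, 0 ≤ g A) {I : Finset ℕ}
    (hI : I ⊆ V) : p ^ #I * binExp V p (fun A => g (A ∪ I)) ≤ binExp V p g := by
  induction I using Finset.induction_on generalizing g with
  | empty => simp
  | insert v I hv ih =>
    have hvV : v ∈ V := hI (mem_insert_self v I)
    have key : p * binExp V p (fun A => g (insert v A)) ≤ binExp V p g := by
      rw [← insert_erase hvV, binExp_insert (notMem_erase v V), binExp_insert (notMem_erase v V)]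
      simp only [insert_idem]
      have h1 := binExp_nonneg (V := V.erase v) hp0 hp1 (fun A _ => hg A)
      have h2 : 0 ≤ (1 - p) * binExp (V.erase v) p g := mul_nonneg (by linarith) h1
      linarith
    have h := ih (g := fun A => g (insert v A)) (fun A => hg _)
      ((subset_insert v I).trans hI)
    rw [card_insert_of_notMem hv, pow_succ]
    simp only [union_insert]
    calc p ^ #I * p * binExp V p (fun A => g (insert v (A ∪ I)))
        = p * (p ^ #I * binExp V p (fun A => g (insert v (A ∪ I)))) := by ring
      _ ≤ p * binExp V p (fun A => g (insert v A)) := mul_le_mul_of_nonneg_left h hp0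
      _ ≤ _ := key

lemma binProb_mono (hp0 : 0 ≤ p) (hp1 : p ≤ 1) {P Q : Finset ℕ → Prop}
    (H : ∀ A ⊆ V, P A → Q A) : binProb V p P ≤ binProb V p Q :=
  binExp_mono hp0 hp1 fun A hA => by
    by_cases hP : P A
    · simp [hP, H A hA hP]
    · simp only [hP, if_false]; split_ifs <;> norm_num

lemma binProb_nonneg (hp0 : 0 ≤ p) (hp1 : p ≤ 1) {P : Finset ℕ → Prop} : 0 ≤ binProb V p P :=
  binExp_nonneg hp0 hp1 fun A _ => by split_ifs <;> norm_num

lemma binProb_superset {B : Finset ℕ} (hB : B ⊆ V) : binProb V p (fun A => B ⊆ A) = p ^ #B := by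
  rw [← binExp_superset hB, binProb]
  exact binExp_congr fun A _ => by split_ifs <;> rfl

lemma binProb_or_le (hp0 : 0 ≤ p) (hp1 : p ≤ 1) {P Q : Finset ℕ → Prop} :
    binProb V p (fun A => P A ∨ Q A) ≤ binProb V p P + binProb V p Q := by
  rw [binProb, binProb, binProb, ← binExp_add]
  refine binExp_mono hp0 hp1 fun A _ => ?_
  by_cases hP : P A <;> by_cases hQ : Q A <;> simp [hP, hQ]

lemma binProb_compl {P : Finset ℕ → Prop} :
    binProb V p (fun A => ¬ P A) = 1 - binProb V p P := by
  have : binProb V p (fun A => ¬ P A) + binProb V p P = 1 := by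
    rw [binProb, binProb, ← binExp_add]
    refine (binExp_congr (h := fun _ => 1) fun A _ => ?_).trans (binExp_const 1)
    by_cases hP : P A <;> simp [hP]
  linarith

lemma binProb_exists_le (hp0 : 0 ≤ p) (hp1 : p ≤ 1) {ι : Type*} (s : Finset ι)
    (P : ι → Finset ℕ → Prop) :
    binProb V p (fun A => ∃ i ∈ s, P i A) ≤ ∑ i ∈ s, binProb V p (P i) := by
  classical
  unfold binProb
  rw [← binExp_sum]
  refine binExp_mono hp0 hp1 fun A _ => ?_
  have h0 : ∀ i ∈ s, (0 : ℝ) ≤ if P i A then 1 else 0 := fun i _ => by split_ifs <;> norm_num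
  split_ifs with h
  · obtain ⟨i, hi, hP⟩ := h
    refine le_trans ?_ (Finset.single_le_sum h0 hi)
    simp [hP]
  · exact Finset.sum_nonneg h0

lemma binProb_mul_le (hp0 : 0 ≤ p) (hp1 : p ≤ 1) {P : Finset ℕ → Prop} {b : ℝ}
    (hg : ∀ A ⊆ V, 0 ≤ g A) (H : ∀ A ⊆ V, P A → b ≤ g A) : binProb V p P * b ≤ binExp V p g := by
  rw [mul_comm, binProb, ← binExp_const_mul]
  refine binExp_mono hp0 hp1 fun A hA => ?_
  by_cases hP : P A
  · simpa [hP] using H A hA hP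
  · simpa [hP] using hg A hA

/-- Chebyshev's inequality. -/
lemma binProb_abs_ge_le (hp0 : 0 ≤ p) (hp1 : p ≤ 1) {m s : ℝ} (hs : 0 ≤ s) :
    binProb V p (fun A => s ≤ |g A - m|) * s ^ 2 ≤ binExp V p (fun A => (g A - m) ^ 2) :=
  binProb_mul_le hp0 hp1 (fun _ _ => sq_nonneg _) fun A _ h => by
    rw [← sq_abs (g A - m)]
    exact pow_le_pow_left₀ hs h 2

/-- Cantelli's inequality, at a deviation of at least one standard deviation. -/
lemma binProb_add_le_half (hp0 : 0 ≤ p) (hp1 : p ≤ 1) {m t : ℝ} (ht : 0 < t)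
    (hm : binExp V p g = m) (hv : binExp V p (fun A => (g A - m) ^ 2) ≤ t ^ 2) :
    binProb V p (fun A => m + t ≤ g A) ≤ 1 / 2 := by
  -- Markov's inequality for the square shifted by t: the expectation is at most 2t², and the square
  -- is at least 4t² on the event.
  have h := binProb_mul_le (V := V) (g := fun A => (g A - m + t) ^ 2)
    (P := fun A => m + t ≤ g A) (b := (2 * t) ^ 2) hp0 hp1 (fun _ _ => sq_nonneg _)
    fun A _ h => pow_le_pow_left₀ (by positivity) (by linarith) 2
  have e : binExp V p (fun A => (g A - m + t) ^ 2)
      = binExp V p (fun A => (g A - m) ^ 2) + t ^ 2 := by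
    have : (fun A => (g A - m + t) ^ 2)
        = fun A => ((g A - m) ^ 2 + (2 * t) * g A) + (t ^ 2 - 2 * t * m) := by
      funext A; ring
    rw [this, binExp_add, binExp_add, binExp_const, binExp_const_mul, hm]
    ring
  rw [e] at h
  have ht2 : 0 < t ^ 2 := by positivity
  nlinarith

/-- Change of measure by the Cauchy–Schwarz inequality. -/
lemma sq_binProb_le (hp0 : 0 < p) (hp1 : p < 1) {q : ℝ} {P : Finset ℕ → Prop} :
    binProb V q P ^ 2 ≤
      binProb V p P * Real.exp (#V * ((q - p) ^ 2 / (p * (1 - p)))) := by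
  classical
  have h1p : 0 < 1 - p := by linarith
  let S := V.powerset.filter P
  have hS : ∀ r : ℝ, binProb V r P = ∑ A ∈ S, r ^ #A * (1 - r) ^ (#V - #A) := fun r => by
    simp only [binProb, binExp, S, Finset.sum_filter, mul_ite, mul_one, mul_zero]
  have hcs : binProb V q P ^ 2 ≤ binProb V p P *
      ∑ A ∈ S, (q ^ 2 / p) ^ #A * ((1 - q) ^ 2 / (1 - p)) ^ (#V - #A) := by
    rw [hS, hS]
    refine Finset.sum_sq_le_sum_mul_sum_of_sq_le_mul _ (fun A hA' => ?_) (fun A _ => ?_)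
      (fun A _ => ?_)
    · positivity
    · have := sq_nonneg (1 - q); positivity
    · refine le_of_eq ?_
      simp only [div_pow]
      field_simp
      rw [← pow_mul, ← pow_mul, ← pow_mul, ← pow_mul, Nat.mul_comm 2, Nat.mul_comm 2]
  refine hcs.trans (mul_le_mul_of_nonneg_left ?_ (binProb_nonneg hp0.le hp1.le))
  have hle : ∑ A ∈ S, (q ^ 2 / p) ^ #A * ((1 - q) ^ 2 / (1 - p)) ^ (#V - #A)
      ≤ ∑ A ∈ V.powerset, (q ^ 2 / p) ^ #A * ((1 - q) ^ 2 / (1 - p)) ^ (#V - #A) :=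
    Finset.sum_le_sum_of_subset_of_nonneg (Finset.filter_subset _ _) fun A _ _ => by
      have := sq_nonneg (1 - q); positivity
  refine hle.trans ?_
  rw [Finset.sum_pow_mul_eq_add_pow, Real.exp_nat_mul]
  have e : q ^ 2 / p + (1 - q) ^ 2 / (1 - p) = (q - p) ^ 2 / (p * (1 - p)) + 1 := by
    field_simp
    ring
  -- Each point contributes 1 plus the χ²-divergence of Bernoulli(q) from Bernoulli(p).
  rw [e]
  exact pow_le_pow_left₀ (by positivity) (Real.add_one_le_exp _) _

end BinExp

/-! ### From `setBernoulli` to finite sums -/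

section Bridge

open Finset

open Classical in
lemma setOf_subset_coe_eq_biUnion (V : Finset ℕ) (T : Set (Set ℕ)) :
    {S ∈ T | S ⊆ (V : Set ℕ)} =
      ⋃ A ∈ V.powerset.filter (fun A : Finset ℕ => (A : Set ℕ) ∈ T), {(A : Set ℕ)} := by
  ext S
  simp only [Set.mem_ofPred_eq, Set.mem_iUnion, Set.mem_singleton_iff, mem_filter, mem_powerset,
    exists_prop]
  constructor
  · rintro ⟨h1, h2⟩
    lift S to Finset ℕ using V.finite_toSet.subset h2
    exact ⟨S, ⟨by exact_mod_cast h2, h1⟩, rfl⟩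
  · rintro ⟨A, ⟨h1, h2⟩, rfl⟩
    exact ⟨h2, by exact_mod_cast h1⟩

lemma pairwiseDisjoint_singleton_coe (s : Set (Finset ℕ)) :
    s.PairwiseDisjoint (fun A : Finset ℕ => ({(A : Set ℕ)} : Set (Set ℕ))) := by
  intro A _ B _ h
  simpa [Function.onFun] using h

lemma setBernoulli_real_eq_binProb (V : Finset ℕ) (p : unitInterval) (P : Set ℕ → Prop) :
    (setBernoulli (V : Set ℕ) p).real {S | P S} = binProb V p (fun A => P A) := by
  classical
  rw [measureReal_def, setBernoulli_apply_eq_apply_subsets, ← measureReal_def]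
  rw [setOf_subset_coe_eq_biUnion,
    measureReal_biUnion_finset (pairwiseDisjoint_singleton_coe _) (by simp), binProb, binExp,
    Finset.sum_filter]
  refine Finset.sum_congr rfl fun A hA => ?_
  have hA := mem_powerset.1 hA
  simp only [Set.mem_ofPred_eq]
  split_ifs
  · rw [setBernoulli_real_singleton p (by exact_mod_cast hA) V.finite_toSet, ← coe_sdiff,
      Set.ncard_coe_finset, Set.ncard_coe_finset, card_sdiff_of_subset hA, mul_one]
  · simp

/-- The law is carried by finitely many atoms, so every real function is a.e. measurable and its
integral is a finite sum. -/
lemma setBernoulli_eq_sum_dirac (V : Finset ℕ) (p : unitInterval) :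
    setBernoulli (V : Set ℕ) p =
      ∑ A ∈ V.powerset, setBernoulli (V : Set ℕ) p {(A : Set ℕ)} • Measure.dirac (A : Set ℕ) := by
  classical
  ext T hT
  rw [setBernoulli_apply_eq_apply_subsets]
  rw [setOf_subset_coe_eq_biUnion, measure_biUnion_finset (pairwiseDisjoint_singleton_coe _) (by simp), Measure.finsetSum_apply,
    Finset.sum_filter]
  refine Finset.sum_congr rfl fun A hA => ?_
  rw [Measure.smul_apply, Measure.dirac_apply' _ hT]
  by_cases h : (A : Set ℕ) ∈ T <;> simp [h]

lemma setBernoulli_aemeasurable (V : Finset ℕ) (p : unitInterval) (f : Set ℕ → ℝ) :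
    AEMeasurable f (setBernoulli (V : Set ℕ) p) := by
  rw [setBernoulli_eq_sum_dirac, ← Measure.sum_coe_finset, aemeasurable_sum_measure_iff]
  exact fun A => aemeasurable_dirac.smul_measure _

lemma setBernoulli_integral_eq_binExp (V : Finset ℕ) (p : unitInterval) (f : Set ℕ → ℝ) :
    ∫ S, f S ∂(setBernoulli (V : Set ℕ) p) = binExp V p (fun A => f A) := by
  rw [setBernoulli_eq_sum_dirac, integral_finsetSum_measure, binExp]
  · refine Finset.sum_congr rfl fun A hA => ?_
    have hA := mem_powerset.1 hA
    rw [integral_smul_measure, integral_dirac, ← measureReal_def,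
      setBernoulli_real_singleton p (by exact_mod_cast hA) V.finite_toSet, ← coe_sdiff,
      Set.ncard_coe_finset, Set.ncard_coe_finset, card_sdiff_of_subset hA, smul_eq_mul]
  · intro A _
    exact (integrable_dirac (by simp)).smul_measure (measure_ne_top _ _)

lemma setBernoulli_variance_eq_binExp (V : Finset ℕ) (p : unitInterval) (f : Set ℕ → ℝ) :
    variance f (setBernoulli (V : Set ℕ) p) =
      binExp V p (fun A => (f A - binExp V p (fun A => f A)) ^ 2) := by
  rw [variance_eq_integral (setBernoulli_aemeasurable V p f), setBernoulli_integral_eq_binExp,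
    setBernoulli_integral_eq_binExp]

end Bridge

/-! ### Variance and matchings in uniform hypergraphs of bounded codegree -/

section Hypergraph

open Finset

/-- The edges of `H` that are contained in `A`. -/
def edgesIn (H : Finset (Finset ℕ)) (A : Finset ℕ) : Finset (Finset ℕ) := H.filter (· ⊆ A)

/-- `H` is a `k`-uniform hypergraph on `V` in which every vertex lies in at most `Δ` edges and every
pair of vertices in at most `D` edges. -/
structure BoundedCodegree (H : Finset (Finset ℕ)) (V : Finset ℕ) (k D Δ : ℕ) : Prop where
  subset : ∀ f ∈ H, f ⊆ V
  card : ∀ f ∈ H, #f = k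
  degree : ∀ v, #{f ∈ H | v ∈ f} ≤ Δ
  codegree : ∀ u v, u ≠ v → #{f ∈ H | u ∈ f ∧ v ∈ f} ≤ D

variable {H : Finset (Finset ℕ)} {V : Finset ℕ} {k D Δ : ℕ} {p : ℝ}

lemma card_edgesIn (A : Finset ℕ) :
    (#(edgesIn H A) : ℝ) = ∑ f ∈ H, if f ⊆ A then (1 : ℝ) else 0 := by
  rw [edgesIn, Finset.card_filter]
  push_cast
  rfl

lemma edgesIn_mono {A B : Finset ℕ} (h : A ⊆ B) : edgesIn H A ⊆ edgesIn H B :=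
  fun f hf => by
    rw [edgesIn, mem_filter] at hf ⊢
    exact ⟨hf.1, hf.2.trans h⟩

lemma binExp_card_edgesIn (hH : BoundedCodegree H V k D Δ) :
    binExp V p (fun A => (#(edgesIn H A) : ℝ)) = #H * p ^ k := by
  simp_rw [card_edgesIn]
  rw [binExp_sum, Finset.sum_congr rfl (g := fun _ => p ^ k)]
  · simp
  · intro f hf
    rw [binExp_superset (hH.subset f hf), hH.card f hf]

lemma binExp_sq_card_edgesIn_sub (hH : BoundedCodegree H V k D Δ) :
    binExp V p (fun A => ((#(edgesIn H A) : ℝ) - #H * p ^ k) ^ 2) =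
      ∑ f ∈ H, ∑ g ∈ H, (p ^ #(f ∪ g) - p ^ (2 * k)) := by
  have h2 : binExp V p (fun A => (#(edgesIn H A) : ℝ) ^ 2) =
      ∑ f ∈ H, ∑ g ∈ H, p ^ #(f ∪ g) := by
    have : ∀ A, (#(edgesIn H A) : ℝ) ^ 2 =
        ∑ f ∈ H, ∑ g ∈ H, if f ∪ g ⊆ A then (1 : ℝ) else 0 := by
      intro A
      rw [card_edgesIn, sq, Finset.sum_mul_sum]
      refine Finset.sum_congr rfl fun f _ => Finset.sum_congr rfl fun g _ => ?_
      by_cases h1 : f ⊆ A <;> by_cases h2 : g ⊆ A <;> simp [h1, h2, union_subset_iff]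
    simp_rw [this]
    rw [binExp_sum]
    refine Finset.sum_congr rfl fun f hf => ?_
    rw [binExp_sum]
    refine Finset.sum_congr rfl fun g hg => ?_
    rw [binExp_superset (union_subset (hH.subset f hf) (hH.subset g hg))]
  have e : (fun A => ((#(edgesIn H A) : ℝ) - #H * p ^ k) ^ 2) =
      fun A => ((#(edgesIn H A) : ℝ) ^ 2 + (-2 * (#H * p ^ k)) * (#(edgesIn H A) : ℝ))
        + (#H * p ^ k) ^ 2 := by
    funext A; ring
  rw [e, binExp_add, binExp_add, binExp_const_mul, binExp_const, h2, binExp_card_edgesIn hH]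
  simp only [Finset.sum_sub_distrib, Finset.sum_const, nsmul_eq_mul]
  ring

lemma sum_degree_eq (hH : BoundedCodegree H V k D Δ) :
    ∑ v ∈ V, #{f ∈ H | v ∈ f} = k * #H := by
  simp_rw [Finset.card_filter]
  rw [Finset.sum_comm, Finset.sum_congr rfl (g := fun _ => k)]
  · simp [mul_comm]
  · intro f hf
    rw [← Finset.card_filter, ← hH.card f hf]
    congr 1
    ext x
    simpa using fun h => hH.subset f hf h

/-- A pair with i ≥ 1 common points contributes at least p^{2k-1}(1-p), hence at least i/k times
that. The sum of all #(f ∩ g) is the sum of the squared degrees, which Cauchy–Schwarz bounds below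
in terms of the degree sum k·#H. -/
lemma variance_lower_bound (hH : BoundedCodegree H V k D Δ) (hp0 : 0 ≤ p) (hp1 : p ≤ 1)
    (hk : 0 < k) :
    k * (#H : ℝ) ^ 2 * (p ^ (2 * k - 1) * (1 - p)) ≤
      #V * ∑ f ∈ H, ∑ g ∈ H, (p ^ #(f ∪ g) - p ^ (2 * k)) := by
  have hkR : (0 : ℝ) < k := by exact_mod_cast hk
  set q := p ^ (2 * k - 1) * (1 - p) with hq
  have hq0 : 0 ≤ q := mul_nonneg (by positivity) (by linarith)
  have hterm : ∀ f ∈ H, ∀ g ∈ H, (#(f ∩ g) : ℝ) * q ≤ k * (p ^ #(f ∪ g) - p ^ (2 * k)) := by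
    intro f hf g hg
    have hc := card_union_add_card_inter f g
    rw [hH.card f hf, hH.card g hg] at hc
    rcases Nat.eq_zero_or_pos (#(f ∩ g)) with h0 | h0
    · rw [h0, show #(f ∪ g) = 2 * k by omega]; simp
    · have hle : #(f ∩ g) ≤ k := by
        rw [← hH.card f hf]; exact card_le_card inter_subset_left
      have h1 : p ^ (2 * k - 1) ≤ p ^ #(f ∪ g) :=
        pow_le_pow_of_le_one hp0 hp1 (by omega)
      have h2 : q ≤ p ^ #(f ∪ g) - p ^ (2 * k) := by
        have : p ^ (2 * k) = p ^ (2 * k - 1) * p := by rw [← pow_succ]; congr 1; omega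
        rw [hq, this]; linarith
      exact mul_le_mul (by exact_mod_cast hle) h2 hq0 (by positivity)
  have hsum : (∑ v ∈ V, (#{f ∈ H | v ∈ f} : ℝ) ^ 2) = ∑ f ∈ H, ∑ g ∈ H, (#(f ∩ g) : ℝ) := by
    have h1 : ∀ v ∈ V, (#{f ∈ H | v ∈ f} : ℝ) ^ 2
        = ∑ f ∈ H, ∑ g ∈ H, if v ∈ f ∩ g then (1 : ℝ) else 0 := by
      intro v _
      rw [Finset.card_filter]
      push_cast
      rw [sq, Finset.sum_mul_sum]
      refine Finset.sum_congr rfl fun f _ => Finset.sum_congr rfl fun g _ => ?_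
      by_cases h1 : v ∈ f <;> by_cases h2 : v ∈ g <;> simp [h1, h2]
    rw [Finset.sum_congr rfl h1, Finset.sum_comm]
    refine Finset.sum_congr rfl fun f hf => ?_
    rw [Finset.sum_comm]
    refine Finset.sum_congr rfl fun g _ => ?_
    rw [Finset.sum_ite_mem, Finset.sum_const, inter_eq_right.2
      (inter_subset_left.trans (hH.subset f hf))]
    simp
  have hcs := sq_sum_le_card_mul_sum_sq (s := V) (f := fun v => (#{f ∈ H | v ∈ f} : ℝ))
  have hdeg : (∑ v ∈ V, (#{f ∈ H | v ∈ f} : ℝ)) = k * #H := by exact_mod_cast sum_degree_eq hH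
  rw [hdeg, hsum] at hcs
  have h3 : (∑ f ∈ H, ∑ g ∈ H, (#(f ∩ g) : ℝ)) * q
      ≤ k * ∑ f ∈ H, ∑ g ∈ H, (p ^ #(f ∪ g) - p ^ (2 * k)) := by
    simp_rw [Finset.sum_mul, Finset.mul_sum]
    exact Finset.sum_le_sum fun f hf => Finset.sum_le_sum fun g hg => hterm f hf g hg
  have h4 := mul_le_mul_of_nonneg_right hcs hq0
  have h5 : (0 : ℝ) ≤ #V := by positivity
  have h6 := mul_le_mul_of_nonneg_left h3 h5
  have h7 : (k : ℝ) * (k * (#H : ℝ) ^ 2 * q) ≤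
      k * (#V * ∑ f ∈ H, ∑ g ∈ H, (p ^ #(f ∪ g) - p ^ (2 * k))) := by
    nlinarith
  exact le_of_mul_le_mul_left h7 hkR

/-- For fixed f, at most kΔ edges meet it in exactly one point (covariance at most p^{2k-1}) and at
most k²D in two or more (covariance at most p^k). -/
lemma variance_upper_bound (hH : BoundedCodegree H V k D Δ) (hp0 : 0 ≤ p) (hp1 : p ≤ 1) :
    ∑ f ∈ H, ∑ g ∈ H, (p ^ #(f ∪ g) - p ^ (2 * k)) ≤
      #H * (k * Δ * p ^ (2 * k - 1) + k ^ 2 * D * p ^ k) := by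
  have hterm : ∀ f ∈ H, ∀ g ∈ H, p ^ #(f ∪ g) - p ^ (2 * k) ≤
      (∑ v ∈ f, (if v ∈ g then (1 : ℝ) else 0) * p ^ (2 * k - 1)) +
        ∑ x ∈ f.offDiag, (if x.1 ∈ g ∧ x.2 ∈ g then (1 : ℝ) else 0) * p ^ k := by
    intro f hf g hg
    have hc := card_union_add_card_inter f g
    rw [hH.card f hf, hH.card g hg] at hc
    have n1 : ∀ v ∈ f, (0 : ℝ) ≤ (if v ∈ g then (1 : ℝ) else 0) * p ^ (2 * k - 1) := by
      intro v _; split_ifs <;> simp; positivity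
    have n2 : ∀ x ∈ f.offDiag,
        (0 : ℝ) ≤ (if x.1 ∈ g ∧ x.2 ∈ g then (1 : ℝ) else 0) * p ^ k := by
      intro v _; split_ifs <;> simp; positivity
    have hpp : 0 ≤ p ^ (2 * k) := by positivity
    rcases Nat.lt_or_ge 1 (#(f ∩ g)) with h1 | h1
    · obtain ⟨a, ha, b, hb, hab⟩ := one_lt_card.1 h1
      rw [mem_inter] at ha hb
      have h3 := Finset.single_le_sum n2 (mem_offDiag.2 ⟨ha.1, hb.1, hab⟩ : (a, b) ∈ f.offDiag)
      simp only [ha.2, hb.2, and_self, if_true, one_mul] at h3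
      have h4 : p ^ #(f ∪ g) ≤ p ^ k := pow_le_pow_of_le_one hp0 hp1 (by
        rw [← hH.card f hf]; exact card_le_card subset_union_left)
      have := Finset.sum_nonneg n1
      linarith
    · rcases Nat.eq_zero_or_pos (#(f ∩ g)) with h0 | h0
      · rw [show #(f ∪ g) = 2 * k by omega, sub_self]
        exact add_nonneg (Finset.sum_nonneg n1) (Finset.sum_nonneg n2)
      · obtain ⟨a, ha⟩ := card_pos.1 h0
        rw [mem_inter] at ha
        have h3 := Finset.single_le_sum n1 ha.1
        simp only [ha.2, if_true, one_mul] at h3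
        have := Finset.sum_nonneg n2
        rw [show #(f ∪ g) = 2 * k - 1 by omega]
        linarith
  have hf : ∀ f ∈ H, ∑ g ∈ H, (p ^ #(f ∪ g) - p ^ (2 * k)) ≤
      k * Δ * p ^ (2 * k - 1) + k ^ 2 * D * p ^ k := by
    intro f hf
    refine (Finset.sum_le_sum fun g hg => hterm f hf g hg).trans ?_
    rw [Finset.sum_add_distrib, Finset.sum_comm, Finset.sum_comm (s := H) (t := f.offDiag)]
    refine add_le_add ?_ ?_
    · refine (Finset.sum_le_card_nsmul f _ (Δ * p ^ (2 * k - 1)) fun v _ => ?_).trans_eq ?_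
      · rw [← Finset.sum_mul, ← Finset.natCast_card_filter]
        exact mul_le_mul_of_nonneg_right (by exact_mod_cast hH.degree v) (by positivity)
      · rw [hH.card f hf, nsmul_eq_mul]; ring
    · refine (Finset.sum_le_card_nsmul f.offDiag _ (D * p ^ k) fun x hx => ?_).trans ?_
      · rw [← Finset.sum_mul, ← Finset.natCast_card_filter]
        exact mul_le_mul_of_nonneg_right
          (by exact_mod_cast hH.codegree x.1 x.2 (mem_offDiag.1 hx).2.2) (by positivity)
      · rw [nsmul_eq_mul, mul_assoc]
        refine mul_le_mul_of_nonneg_right ?_ (by positivity)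
        rw [offDiag_card, hH.card f hf, sq]
        exact_mod_cast Nat.sub_le _ _
  refine (Finset.sum_le_card_nsmul H _ _ hf).trans_eq ?_
  rw [nsmul_eq_mul]

/-- The number of ordered `r`-tuples of pairwise disjoint members of `J`. -/
def matchCount : ℕ → Finset (Finset ℕ) → ℕ
  | 0, _ => 1
  | r + 1, J => ∑ f ∈ J, matchCount r (J.filter (Disjoint f))

lemma matchCount_mono (r : ℕ) {J J' : Finset (Finset ℕ)} (h : J ⊆ J') :
    matchCount r J ≤ matchCount r J' := by
  induction r generalizing J J' with
  | zero => simp [matchCount]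
  | succ r ih =>
    exact (Finset.sum_le_sum fun f _ => ih (filter_subset_filter _ h)).trans
      (Finset.sum_le_sum_of_subset h)

/-- Greedy choice: each chosen member excludes at most M others, so each of the r choices has at
least b options. -/
lemma pow_le_matchCount (r : ℕ) {J : Finset (Finset ℕ)} {b M : ℝ} (hb : 0 ≤ b) (hM : 0 ≤ M)
    (hJ : ∀ f ∈ J, (#{g ∈ J | ¬ Disjoint f g} : ℝ) ≤ M) (hc : b + r * M ≤ #J) :
    b ^ r ≤ matchCount r J := by
  induction r generalizing J with
  | zero => simp [matchCount]
  | succ r ih =>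
    push_cast at hc
    have h1 : ∀ f ∈ J, b ^ r ≤ (matchCount r (J.filter (Disjoint f)) : ℝ) := by
      intro f hf
      refine ih (fun g hg => ?_) ?_
      · refine le_trans ?_ (hJ g (mem_filter.1 hg).1)
        exact_mod_cast card_le_card (filter_subset_filter _ (filter_subset _ _))
      · have h2 : #{g ∈ J | Disjoint f g} + #{g ∈ J | ¬ Disjoint f g} = #J :=
          Finset.card_filter_add_card_filter_not _
        have h3 : (#{g ∈ J | Disjoint f g} : ℝ) + #{g ∈ J | ¬ Disjoint f g} = #J := by
          exact_mod_cast h2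
        linarith [hJ f hf]
    have h4 := Finset.card_nsmul_le_sum J _ _ h1
    rw [nsmul_eq_mul] at h4
    rw [matchCount, pow_succ']
    push_cast
    refine le_trans (mul_le_mul_of_nonneg_right ?_ (by positivity)) h4
    have : 0 ≤ (r : ℝ) * M := by positivity
    linarith

/-- Disjoint edges are present independently, so each further edge costs a factor #H p^k. The set B
holds the points already used, which makes the induction close. -/
lemma binExp_matchCount_le (hH : BoundedCodegree H V k D Δ) (hp0 : 0 ≤ p) (hp1 : p ≤ 1) (r : ℕ)
    {B : Finset ℕ} (hB : B ⊆ V) :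
    binExp V p (fun A => if B ⊆ A then
        (matchCount r ((edgesIn H A).filter (Disjoint B)) : ℝ) else 0) ≤
      p ^ #B * (#H * p ^ k) ^ r := by
  induction r generalizing B with
  | zero => simp [matchCount, binExp_superset hB]
  | succ r ih =>
    have h1 : ∀ A ⊆ V, (if B ⊆ A then
        (matchCount (r + 1) ((edgesIn H A).filter (Disjoint B)) : ℝ) else 0) ≤
        ∑ f ∈ H.filter (Disjoint B), if B ∪ f ⊆ A then
          (matchCount r ((edgesIn H A).filter (Disjoint (B ∪ f))) : ℝ) else 0 := by
      intro A _
      have n1 : ∀ f ∈ H.filter (Disjoint B), (0 : ℝ) ≤ if B ∪ f ⊆ A then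
          (matchCount r ((edgesIn H A).filter (Disjoint (B ∪ f))) : ℝ) else 0 := by
        intro f _; split_ifs <;> positivity
      split_ifs with hBA
      · rw [matchCount]
        push_cast
        have hs : (edgesIn H A).filter (Disjoint B) ⊆ H.filter (Disjoint B) :=
          filter_subset_filter _ (filter_subset _ _)
        refine le_trans (le_of_eq ?_)
          (Finset.sum_le_sum_of_subset_of_nonneg hs fun f hf _ => n1 f hf)
        refine Finset.sum_congr rfl fun f hf => ?_
        simp only [edgesIn, mem_filter] at hf
        rw [if_pos (union_subset hBA hf.1.2), filter_filter]
        congr 2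
        refine filter_congr fun g _ => ?_
        rw [disjoint_union_left]
      · exact Finset.sum_nonneg n1
    refine (binExp_mono hp0 hp1 h1).trans ?_
    rw [binExp_sum]
    have h2 : ∀ f ∈ H.filter (Disjoint B), binExp V p (fun A => if B ∪ f ⊆ A then
          (matchCount r ((edgesIn H A).filter (Disjoint (B ∪ f))) : ℝ) else 0) ≤
          p ^ #B * p ^ k * (#H * p ^ k) ^ r := by
      intro f hf
      rw [mem_filter] at hf
      refine (ih (union_subset hB (hH.subset f hf.1))).trans_eq ?_
      rw [card_union_of_disjoint hf.2, hH.card f hf.1, pow_add]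
    refine (Finset.sum_le_card_nsmul _ _ _ h2).trans ?_
    rw [nsmul_eq_mul, pow_succ]
    have h3 : (#(H.filter (Disjoint B)) : ℝ) ≤ #H := by
      exact_mod_cast card_le_card (filter_subset _ _)
    calc _ ≤ (#H : ℝ) * (p ^ #B * p ^ k * (#H * p ^ k) ^ r) :=
          mul_le_mul_of_nonneg_right h3 (by positivity)
      _ = _ := by ring

/-- Upper tail bound for the size of subfamilies with bounded intersections. -/
lemma binProb_exists_sparse_le (hH : BoundedCodegree H V k D Δ) (hp0 : 0 ≤ p) (hp1 : p ≤ 1)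
    (r : ℕ) {b M : ℝ} (hb : 0 < b) (hM : 0 ≤ M) :
    binProb V p (fun A => ∃ J ⊆ edgesIn H A, (∀ f ∈ J, (#{g ∈ J | ¬ Disjoint f g} : ℝ) ≤ M) ∧
      b + r * M ≤ #J) ≤ (#H * p ^ k / b) ^ r := by
  have h := binExp_matchCount_le hH hp0 hp1 r (empty_subset V)
  simp only [empty_subset, if_true, card_empty, pow_zero, one_mul, disjoint_empty_left,
    filter_true] at h
  rw [div_pow, le_div_iff₀ (by positivity)]
  -- Markov's inequality for the number of ordered r-matchings.
  refine (binProb_mul_le hp0 hp1 (fun A _ => by positivity) fun A _ hA => ?_).trans h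
  obtain ⟨J, hJ, hd, hc⟩ := hA
  refine (pow_le_matchCount r hb.le hM hd hc).trans ?_
  exact_mod_cast matchCount_mono r hJ

end Hypergraph

/-! ### Stars and vertices of large degree -/

section Stars

open Finset

variable {H : Finset (Finset ℕ)} {V : Finset ℕ} {k D Δ s : ℕ} {p : ℝ}

/-- The degree of `v` in the subhypergraph of `H` induced by `A`. -/
def degIn (H : Finset (Finset ℕ)) (A : Finset ℕ) (v : ℕ) : ℕ := #{f ∈ edgesIn H A | v ∈ f}

/-- `F` consists of `s` edges of `H` that contain `v` and are otherwise pairwise disjoint. -/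
structure IsStar (H : Finset (Finset ℕ)) (s v : ℕ) (F : Finset (Finset ℕ)) : Prop where
  subset : F ⊆ H
  card : #F = s
  mem : ∀ f ∈ F, v ∈ f
  disjoint : ∀ f ∈ F, ∀ g ∈ F, f ≠ g → Disjoint (f.erase v) (g.erase v)

/-- `A` contains `r` pairwise disjoint stars with `s` edges each, all disjoint from `B`. -/
def HasStars (H : Finset (Finset ℕ)) (s : ℕ) : ℕ → Finset ℕ → Finset ℕ → Prop
  | 0, _, _ => True
  | r + 1, B, A => ∃ v F, IsStar H s v F ∧ F.biUnion id ⊆ A ∧ Disjoint B (F.biUnion id) ∧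
      HasStars H s r (B ∪ F.biUnion id) A

lemma IsStar.le_card_biUnion (hH : BoundedCodegree H V k D Δ) {v : ℕ} {F : Finset (Finset ℕ)}
    (hF : IsStar H s v F) : (k - 1) * s ≤ #(F.biUnion id) := by
  have h1 : #(F.biUnion fun f => f.erase v) = (k - 1) * s := by
    rw [card_biUnion fun f hf g hg => hF.disjoint f hf g hg, Finset.sum_congr rfl
      (g := fun _ => k - 1), Finset.sum_const, hF.card, smul_eq_mul, mul_comm]
    intro f hf
    rw [card_erase_of_mem (hF.mem f hf), hH.card f (hF.subset hf)]
  rw [← h1]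
  exact card_le_card (biUnion_mono fun f _ => erase_subset v f)

lemma IsStar.card_biUnion_le (hH : BoundedCodegree H V k D Δ) {v : ℕ} {F : Finset (Finset ℕ)}
    (hF : IsStar H s v F) : #(F.biUnion id) ≤ k * s := by
  refine Finset.card_biUnion_le.trans ((Finset.sum_le_card_nsmul F _ k fun f hf => ?_).trans ?_)
  · exact (hH.card f (hF.subset hf)).le
  · rw [hF.card, smul_eq_mul, mul_comm]

/-- Union bound over one star at a time: a centre, then s of the at most Δ edges through it, which
together cover at least (k-1)s points outside B. Disjointness lets the costs multiply. -/
lemma binProb_hasStars_le (hH : BoundedCodegree H V k D Δ) (hp0 : 0 ≤ p) (hp1 : p ≤ 1)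
    (hs : 0 < s) (r : ℕ) {B : Finset ℕ} (hB : B ⊆ V) :
    binProb V p (fun A => B ⊆ A ∧ HasStars H s r B A) ≤
      p ^ #B * (#V * (Δ.choose s * p ^ ((k - 1) * s))) ^ r := by
  induction r generalizing B with
  | zero => simp [HasStars, binProb_superset hB]
  | succ r ih =>
    classical
    let T : ℕ → Finset (Finset (Finset ℕ)) := fun v =>
      (powersetCard s {f ∈ H | v ∈ f}).filter
        fun F => IsStar H s v F ∧ Disjoint B (F.biUnion id)
    let Q : ℕ → Finset (Finset ℕ) → Finset ℕ → Prop := fun v F A =>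
      B ∪ F.biUnion id ⊆ A ∧ HasStars H s r (B ∪ F.biUnion id) A
    have h1 : ∀ A ⊆ V, B ⊆ A ∧ HasStars H s (r + 1) B A → ∃ v ∈ V, ∃ F ∈ T v, Q v F A := by
      rintro A - ⟨hBA, v, F, hF, hFA, hd, hr⟩
      obtain ⟨f, hf⟩ := card_pos.1 (hF.card ▸ hs)
      refine ⟨v, hH.subset f (hF.subset hf) (hF.mem f hf), F, ?_, union_subset hBA hFA, hr⟩
      simp only [T, mem_filter, mem_powersetCard]
      exact ⟨⟨fun g hg => mem_filter.2 ⟨hF.subset hg, hF.mem g hg⟩, hF.card⟩, hF, hd⟩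
    refine (binProb_mono hp0 hp1 h1).trans ((binProb_exists_le hp0 hp1 _ _).trans ?_)
    have h2 : ∀ v ∈ V, binProb V p (fun A => ∃ F ∈ T v, Q v F A) ≤
        Δ.choose s * (p ^ #B * p ^ ((k - 1) * s) *
          (#V * (Δ.choose s * p ^ ((k - 1) * s))) ^ r) := by
      intro v _
      refine (binProb_exists_le hp0 hp1 _ _).trans ?_
      refine (Finset.sum_le_card_nsmul (T v) _ (p ^ #B * p ^ ((k - 1) * s) *
          (#V * (Δ.choose s * p ^ ((k - 1) * s))) ^ r) fun F hF => ?_).trans ?_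
      · simp only [T, mem_filter] at hF
        have hU : F.biUnion id ⊆ V :=
          biUnion_subset.2 fun f hf => hH.subset f (hF.2.1.subset hf)
        refine (ih (union_subset hB hU)).trans ?_
        rw [card_union_of_disjoint hF.2.2, pow_add]
        refine mul_le_mul_of_nonneg_right ?_ (by positivity)
        exact mul_le_mul_of_nonneg_left
          (pow_le_pow_of_le_one hp0 hp1 (hF.2.1.le_card_biUnion hH)) (by positivity)
      · rw [nsmul_eq_mul]
        refine mul_le_mul_of_nonneg_right ?_ (by positivity)
        have h3 : #(T v) ≤ Δ.choose s := by
          refine (card_le_card (filter_subset _ _)).trans ?_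
          rw [card_powersetCard]
          exact Nat.choose_le_choose s (hH.degree v)
        exact_mod_cast h3
    refine (Finset.sum_le_card_nsmul V _ _ h2).trans_eq ?_
    rw [nsmul_eq_mul]
    ring

/-- Stars are picked greedily. The process stops after at most r of them, and the points they cover,
together with B, meet every star in A. -/
lemma exists_card_le_of_not_hasStars (hH : BoundedCodegree H V k D Δ) (r : ℕ) {B A : Finset ℕ}
    (h : ¬ HasStars H s (r + 1) B A) :
    ∃ B', #B' ≤ #B + r * (k * s) ∧ ∀ v F, IsStar H s v F → F.biUnion id ⊆ A →
      ¬ Disjoint B' (F.biUnion id) := by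
  induction r generalizing B with
  | zero =>
    exact ⟨B, by simp, fun v F hF hA hd => h ⟨v, F, hF, hA, hd, trivial⟩⟩
  | succ r ih =>
    by_cases hex : ∃ v F, IsStar H s v F ∧ F.biUnion id ⊆ A ∧ Disjoint B (F.biUnion id)
    · obtain ⟨v, F, hF, hA, hd⟩ := hex
      obtain ⟨B', hc, hB'⟩ := ih (B := B ∪ F.biUnion id) fun hr => h ⟨v, F, hF, hA, hd, hr⟩
      refine ⟨B', hc.trans ?_, hB'⟩
      have h1 := card_union_le B (F.biUnion id)
      have h2 := hF.card_biUnion_le hH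
      rw [Nat.succ_mul]
      omega
    · push Not at hex
      exact ⟨B, by simp, hex⟩

/-- Greedy choice of petals: s petals cover at most ks points besides v, and each of these shares at
most D edges with v, so at most kDs edges at v are blocked. -/
lemma exists_isStar (hH : BoundedCodegree H V k D Δ) (hk : 2 ≤ k) {v : ℕ}
    {G : Finset (Finset ℕ)} (hG : G ⊆ H) (hv : ∀ f ∈ G, v ∈ f) (s : ℕ) (hc : k * D * s < #G) :
    ∃ F ⊆ G, IsStar H s v F := by
  induction s with
  | zero => exact ⟨∅, empty_subset _, by simp, rfl, by simp, by simp⟩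
  | succ s ih =>
    obtain ⟨F, hFG, hF⟩ := ih (lt_of_le_of_lt (Nat.mul_le_mul_left _ (Nat.le_succ s)) hc)
    let W := F.biUnion fun f => f.erase v
    have hW : #W ≤ k * s := (card_le_card (biUnion_mono fun f _ => erase_subset v f)).trans
      (hF.card_biUnion_le hH)
    have hbad : #{f ∈ G | ¬ Disjoint W (f.erase v)} ≤ k * D * s := by
      have hsub : {f ∈ G | ¬ Disjoint W (f.erase v)} ⊆
          W.biUnion fun w => {f ∈ H | v ∈ f ∧ w ∈ f} := by
        intro f hf
        rw [mem_filter, not_disjoint_iff] at hf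
        obtain ⟨hfG, w, hw, hwf⟩ := hf
        rw [mem_biUnion]
        exact ⟨w, hw, mem_filter.2 ⟨hG hfG, hv f hfG, mem_of_mem_erase hwf⟩⟩
      refine (card_le_card hsub).trans (Finset.card_biUnion_le.trans
        ((Finset.sum_le_card_nsmul W _ D fun w hw => ?_).trans ?_))
      · refine hH.codegree v w ?_
        obtain ⟨f, -, hf⟩ := mem_biUnion.1 hw
        exact (ne_of_mem_erase hf).symm
      · rw [smul_eq_mul, mul_assoc, mul_left_comm, mul_comm]
        exact Nat.mul_le_mul_left D hW
    have hlt : #{f ∈ G | ¬ Disjoint W (f.erase v)} < #G :=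
      lt_of_le_of_lt (hbad.trans (Nat.mul_le_mul_left _ (Nat.le_succ s))) hc
    obtain ⟨f, hfG, hf⟩ := exists_mem_notMem_of_card_lt_card hlt
    have hd : Disjoint W (f.erase v) := by
      by_contra h
      exact hf (mem_filter.2 ⟨hfG, h⟩)
    have hdF : ∀ g ∈ F, Disjoint (g.erase v) (f.erase v) := fun g hg =>
      hd.mono_left (subset_biUnion_of_mem (fun f => f.erase v) hg)
    have hfF : f ∉ F := by
      intro h
      have h0 := disjoint_self.1 (hdF f h)
      have h1 := card_erase_of_mem (hv f hfG)
      rw [h0, hH.card f (hG hfG)] at h1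
      simp at h1
      omega
    refine ⟨insert f F, insert_subset hfG hFG, (insert_subset hfG hFG).trans hG, ?_, ?_, ?_⟩
    · rw [card_insert_of_notMem hfF, hF.card]
    · exact fun g hg => hv g (insert_subset hfG hFG hg)
    · intro g hg g' hg' hne
      rcases mem_insert.1 hg with rfl | h1 <;> rcases mem_insert.1 hg' with rfl | h2
      · exact absurd rfl hne
      · exact (hdF g' h2).symm
      · exact hdF g h1
      · exact hF.disjoint g h1 g' h2 hne

/-- The sum of the degrees in `A` of the vertices of degree at least `y`. -/
noncomputable def heavyDegree (H : Finset (Finset ℕ)) (V A : Finset ℕ) (y : ℝ) : ℝ :=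
  ∑ v ∈ V, if y ≤ degIn H A v then (degIn H A v : ℝ) else 0

/-- At a vertex of degree at least y, at most kDs edges avoid B, since more would contain a star
avoiding B. Hence at least half of its edges meet B; each such edge is counted at its k vertices and
is charged to a point of B. -/
lemma heavyDegree_le_sum_degIn (hH : BoundedCodegree H V k D Δ) (hk : 2 ≤ k) {A B : Finset ℕ}
    (hB : ∀ v F, IsStar H s v F → F.biUnion id ⊆ A → ¬ Disjoint B (F.biUnion id))
    {y : ℝ} (hy : 2 * (k * D * s) ≤ y) :
    heavyDegree H V A y ≤ 2 * (k * ∑ u ∈ B, (degIn H A u : ℝ)) := by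
  have h1 : ∀ v ∈ V, (if y ≤ degIn H A v then (degIn H A v : ℝ) else 0) ≤
      2 * #{f ∈ edgesIn H A | v ∈ f ∧ ¬ Disjoint B f} := by
    intro v _
    split_ifs with hv
    · have hsplit : #{f ∈ edgesIn H A | v ∈ f ∧ Disjoint B f} +
          #{f ∈ edgesIn H A | v ∈ f ∧ ¬ Disjoint B f} = degIn H A v := by
        rw [degIn, ← Finset.card_filter_add_card_filter_not (s := {f ∈ edgesIn H A | v ∈ f})
          (fun f => Disjoint B f), filter_filter, filter_filter]
      have hle : #{f ∈ edgesIn H A | v ∈ f ∧ Disjoint B f} ≤ k * D * s := by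
        by_contra hlt
        push Not at hlt
        obtain ⟨F, hFG, hF⟩ := exists_isStar hH hk (v := v)
          ((filter_subset _ _).trans (filter_subset _ _))
          (fun f hf => (mem_filter.1 hf).2.1) s hlt
        refine hB v F hF (biUnion_subset.2 fun f hf => ?_) ?_
        · exact (mem_filter.1 (mem_filter.1 (hFG hf)).1).2
        · exact (disjoint_biUnion_right _ _ _).2 fun f hf => (mem_filter.1 (hFG hf)).2.2
      have hle' : (#{f ∈ edgesIn H A | v ∈ f ∧ Disjoint B f} : ℝ) ≤ k * D * s := by
        exact_mod_cast hle
      have hsplit' : (#{f ∈ edgesIn H A | v ∈ f ∧ Disjoint B f} : ℝ) +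
          #{f ∈ edgesIn H A | v ∈ f ∧ ¬ Disjoint B f} = degIn H A v := by exact_mod_cast hsplit
      linarith
    · positivity
  have h2 : ∑ v ∈ V, #{f ∈ edgesIn H A | v ∈ f ∧ ¬ Disjoint B f} =
      k * #{f ∈ edgesIn H A | ¬ Disjoint B f} := by
    have : ∀ v, #{f ∈ edgesIn H A | v ∈ f ∧ ¬ Disjoint B f} =
        ∑ f ∈ {f ∈ edgesIn H A | ¬ Disjoint B f}, if v ∈ f then 1 else 0 := by
      intro v
      rw [← Finset.card_filter, filter_filter]
      simp_rw [and_comm]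
    simp_rw [this]
    rw [Finset.sum_comm, Finset.sum_congr rfl (g := fun _ => k)]
    · simp [mul_comm]
    · intro f hf
      have hfH : f ∈ H := (mem_filter.1 (mem_filter.1 hf).1).1
      rw [← Finset.card_filter, ← hH.card f hfH]
      congr 1
      ext x
      simpa using fun h => hH.subset f hfH h
  have h3 : #{f ∈ edgesIn H A | ¬ Disjoint B f} ≤ ∑ u ∈ B, degIn H A u := by
    have hsub : {f ∈ edgesIn H A | ¬ Disjoint B f} ⊆
        B.biUnion fun u => {f ∈ edgesIn H A | u ∈ f} := by
      intro f hf
      rw [mem_filter, not_disjoint_iff] at hf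
      obtain ⟨hf, u, hu, huf⟩ := hf
      exact mem_biUnion.2 ⟨u, hu, mem_filter.2 ⟨hf, huf⟩⟩
    exact (card_le_card hsub).trans Finset.card_biUnion_le
  have h2' : ∑ v ∈ V, (#{f ∈ edgesIn H A | v ∈ f ∧ ¬ Disjoint B f} : ℝ) =
      k * #{f ∈ edgesIn H A | ¬ Disjoint B f} := by exact_mod_cast h2
  have h3' : (#{f ∈ edgesIn H A | ¬ Disjoint B f} : ℝ) ≤ ∑ u ∈ B, (degIn H A u : ℝ) := by
    exact_mod_cast h3
  refine (Finset.sum_le_sum h1).trans ?_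
  rw [← Finset.mul_sum, h2']
  gcongr

lemma sum_degIn_le (hH : BoundedCodegree H V k D Δ) (A B : Finset ℕ) {y : ℝ} (hy : 0 ≤ y) :
    ∑ u ∈ B, (degIn H A u : ℝ) ≤ #B * y + heavyDegree H V A y := by
  have h1 : ∀ u ∈ B, (degIn H A u : ℝ) ≤
      y + if u ∈ V then (if y ≤ degIn H A u then (degIn H A u : ℝ) else 0) else 0 := by
    intro u _
    split_ifs with h1 h2
    · linarith
    · linarith
    · have : degIn H A u = 0 := by
        rw [degIn, card_eq_zero, filter_eq_empty_iff]
        intro f hf hu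
        exact h1 (hH.subset f (mem_filter.1 hf).1 hu)
      rw [this]
      simpa using hy
  refine (Finset.sum_le_sum h1).trans ?_
  rw [Finset.sum_add_distrib, Finset.sum_const, nsmul_eq_mul, Finset.sum_ite_mem]
  refine add_le_add le_rfl (Finset.sum_le_sum_of_subset_of_nonneg inter_subset_right ?_)
  intro v _ _
  split_ifs <;> positivity

/-- The recursive step, trading the threshold y for y'. It is useful with y' much larger than y, the
set B being small. -/
lemma heavyDegree_le_of_not_hasStars (hH : BoundedCodegree H V k D Δ) (hk : 2 ≤ k)
    {A : Finset ℕ} {r : ℕ} (hr : ¬ HasStars H s (r + 1) ∅ A) {y y' : ℝ}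
    (hy : 2 * (k * D * s) ≤ y) (hy' : 0 ≤ y') :
    heavyDegree H V A y ≤ 2 * (k * (r * (k * s) * y' + heavyDegree H V A y')) := by
  obtain ⟨B, hc, hB⟩ := exists_card_le_of_not_hasStars hH r hr
  rw [card_empty, zero_add] at hc
  have hc' : (#B : ℝ) ≤ r * (k * s) := by exact_mod_cast hc
  refine (heavyDegree_le_sum_degIn hH hk hB hy).trans ?_
  have h1 := sum_degIn_le hH A B hy'
  have h2 : (#B : ℝ) * y' ≤ r * (k * s) * y' := mul_le_mul_of_nonneg_right hc' hy'
  gcongr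
  linarith

/-- The end of the recursion: without a single star, no degree exceeds kDs. -/
lemma heavyDegree_eq_zero_of_not_hasStars (hH : BoundedCodegree H V k D Δ) (hk : 2 ≤ k)
    {A : Finset ℕ} (hr : ¬ HasStars H s 1 ∅ A) {y : ℝ} (hy : k * D * s < y) :
    heavyDegree H V A y = 0 := by
  refine Finset.sum_eq_zero fun v _ => if_neg fun hle => ?_
  have hlt : k * D * s < degIn H A v := by exact_mod_cast hy.trans_le hle
  obtain ⟨F, hFG, hF⟩ := exists_isStar hH hk (v := v)
    ((filter_subset _ _).trans (filter_subset _ _)) (fun f hf => (mem_filter.1 hf).2) s hlt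
  refine hr ⟨v, F, hF, biUnion_subset.2 fun f hf => ?_, disjoint_empty_left _, trivial⟩
  exact (mem_filter.1 (mem_filter.1 (hFG hf)).1).2

/-- Deleting the edges that meet a vertex of large degree leaves a family with bounded
intersections. -/
lemma exists_sparse_of_heavyDegree (hH : BoundedCodegree H V k D Δ) (A : Finset ℕ) {y : ℝ} :
    ∃ J ⊆ edgesIn H A, (∀ f ∈ J, (#{g ∈ J | ¬ Disjoint f g} : ℝ) ≤ k * y) ∧
      #(edgesIn H A) - heavyDegree H V A y ≤ (#J : ℝ) := by
  classical
  let J := {f ∈ edgesIn H A | ∀ v ∈ f, (degIn H A v : ℝ) < y}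
  refine ⟨J, filter_subset _ _, fun f hf => ?_, ?_⟩
  · have hf' := mem_filter.1 hf
    have hsub : {g ∈ J | ¬ Disjoint f g} ⊆ f.biUnion fun v => {g ∈ edgesIn H A | v ∈ g} := by
      intro g hg
      rw [mem_filter, not_disjoint_iff] at hg
      obtain ⟨hg, v, hv, hvg⟩ := hg
      exact mem_biUnion.2 ⟨v, hv, mem_filter.2 ⟨(mem_filter.1 hg).1, hvg⟩⟩
    have h1 : (#{g ∈ J | ¬ Disjoint f g} : ℝ) ≤ ∑ v ∈ f, (degIn H A v : ℝ) := by
      exact_mod_cast (card_le_card hsub).trans Finset.card_biUnion_le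
    refine h1.trans ((Finset.sum_le_card_nsmul f _ y fun v hv => (hf'.2 v hv).le).trans_eq ?_)
    rw [nsmul_eq_mul, hH.card f (mem_filter.1 hf'.1).1]
  · have h1 := Finset.card_filter_add_card_filter_not (s := edgesIn H A)
      (fun f => ∀ v ∈ f, (degIn H A v : ℝ) < y)
    have hsub : {f ∈ edgesIn H A | ¬ ∀ v ∈ f, (degIn H A v : ℝ) < y} ⊆
        {v ∈ V | y ≤ degIn H A v}.biUnion fun v => {g ∈ edgesIn H A | v ∈ g} := by
      intro f hf
      obtain ⟨hf, h⟩ := mem_filter.1 hf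
      push Not at h
      obtain ⟨v, hv, hy⟩ := h
      exact mem_biUnion.2 ⟨v, mem_filter.2 ⟨hH.subset f (mem_filter.1 hf).1 hv, hy⟩,
        mem_filter.2 ⟨hf, hv⟩⟩
    have h2 : (#{f ∈ edgesIn H A | ¬ ∀ v ∈ f, (degIn H A v : ℝ) < y} : ℝ) ≤
        heavyDegree H V A y := by
      rw [heavyDegree, ← Finset.sum_filter]
      exact_mod_cast (card_le_card hsub).trans Finset.card_biUnion_le
    have h3 : (#J : ℝ) + #{f ∈ edgesIn H A | ¬ ∀ v ∈ f, (degIn H A v : ℝ) < y} =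
        #(edgesIn H A) := by exact_mod_cast h1
    linarith

end Stars

/-! ### Arithmetic progressions as a hypergraph -/

section ArithProgs

open Finset

variable {k n : ℕ}

lemma mem_arithProgs {f : Finset ℕ} :
    f ∈ arithProgs k n ↔ f ⊆ Icc 1 n ∧ IsArithProg k f := by
  classical
  rw [arithProgs, mem_filter, mem_powerset]

lemma arithProgCount_coe (A : Finset ℕ) :
    arithProgCount k n A = #(edgesIn (arithProgs k n) A) := by
  classical
  rw [arithProgCount, edgesIn]
  congr 2
  exact filter_congr fun f _ => coe_subset

lemma edgesIn_arithProgs_Icc {m : ℕ} (hm : m ≤ n) :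
    edgesIn (arithProgs k n) (Icc 1 m) = arithProgs k m := by
  ext f
  rw [edgesIn, mem_filter, mem_arithProgs, mem_arithProgs]
  exact ⟨fun h => ⟨h.2, h.1.2⟩, fun h => ⟨⟨h.1.trans (Icc_subset_Icc_right hm), h.2⟩, h.1⟩⟩

lemma exists_of_mem_arithProgs (hk : 2 ≤ k) {f : Finset ℕ} (hf : f ∈ arithProgs k n) :
    ∃ a ∈ Icc 1 n, ∃ d ∈ Icc 1 n, f = (range k).image (fun i => a + i * d) := by
  obtain ⟨hf, a, d, hd, rfl⟩ := mem_arithProgs.1 hf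
  have ha : a ∈ Icc 1 n := hf (mem_image.2 ⟨0, mem_range.2 (by omega), by simp⟩)
  have had : a + d ∈ Icc 1 n := hf (mem_image.2 ⟨1, mem_range.2 (by omega), by simp⟩)
  rw [mem_Icc] at had
  exact ⟨a, ha, d, mem_Icc.2 ⟨hd, by omega⟩, rfl⟩

lemma card_arithProgs_le (hk : 2 ≤ k) : #(arithProgs k n) ≤ n ^ 2 := by
  have hsub : arithProgs k n ⊆ (Icc 1 n ×ˢ Icc 1 n).image
      fun x : ℕ × ℕ => (range k).image (fun i => x.1 + i * x.2) := by
    intro f hf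
    obtain ⟨a, ha, d, hd, rfl⟩ := exists_of_mem_arithProgs hk hf
    exact mem_image.2 ⟨(a, d), mem_product.2 ⟨ha, hd⟩, rfl⟩
  refine (card_le_card hsub).trans (card_image_le.trans_eq ?_)
  simp [sq]

lemma le_card_arithProgs (hk : 2 ≤ k) (hn : 2 * k ≤ n) :
    (n : ℝ) ^ 2 ≤ 16 * k * #(arithProgs k n) := by
  have hinj : Set.InjOn (fun x : ℕ × ℕ => (range k).image (fun i => x.1 + i * x.2))
      (Icc 1 (n / 2) ×ˢ Icc 1 (n / (2 * k)) : Finset (ℕ × ℕ)) := by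
    -- The least element determines a, and then the greatest determines d. One inequality suffices,
    -- by symmetry.
    have key : ∀ a d a' d' : ℕ, (range k).image (fun i => a + i * d) =
        (range k).image (fun i => a' + i * d') → a ≤ a' ∧ (a = a' → d ≤ d') := by
      intro a d a' d' h
      constructor
      · have h1 : a' ∈ (range k).image (fun i => a' + i * d') :=
          mem_image.2 ⟨0, mem_range.2 (by omega), by simp⟩
        rw [← h] at h1
        obtain ⟨i, -, hi⟩ := mem_image.1 h1
        omega
      · rintro rfl
        have h1 : a + (k - 1) * d ∈ (range k).image (fun i => a + i * d) :=
          mem_image.2 ⟨k - 1, mem_range.2 (by omega), rfl⟩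
        rw [h] at h1
        obtain ⟨i, hi, hi'⟩ := mem_image.1 h1
        rw [mem_range] at hi
        have h2 : (k - 1) * d = i * d' := by omega
        have h3 : i * d' ≤ (k - 1) * d' := Nat.mul_le_mul_right d' (by omega)
        exact Nat.le_of_mul_le_mul_left (h2.le.trans h3) (by omega)
    rintro ⟨a, d⟩ - ⟨a', d'⟩ - h
    obtain ⟨h1, h2⟩ := key a d a' d' h
    obtain ⟨h3, h4⟩ := key a' d' a d h.symm
    have h5 : a = a' := le_antisymm h1 h3
    rw [Prod.mk.injEq]
    exact ⟨h5, le_antisymm (h2 h5) (h4 h5.symm)⟩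
  have hsub : (Icc 1 (n / 2) ×ˢ Icc 1 (n / (2 * k))).image
      (fun x : ℕ × ℕ => (range k).image (fun i => x.1 + i * x.2)) ⊆ arithProgs k n := by
    intro f hf
    obtain ⟨⟨a, d⟩, had, rfl⟩ := mem_image.1 hf
    simp only [mem_product, mem_Icc] at had
    refine mem_arithProgs.2 ⟨fun x hx => ?_, a, d, by omega, rfl⟩
    obtain ⟨i, hi, rfl⟩ := mem_image.1 hx
    rw [mem_range] at hi
    have h1 : i * d ≤ k * (n / (2 * k)) := Nat.mul_le_mul hi.le had.2.2
    have h2 : k * (n / (2 * k)) ≤ n / 2 := by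
      rw [← Nat.div_div_eq_div_mul]
      exact Nat.mul_div_le _ _
    rw [mem_Icc]
    dsimp only
    omega
  have h1 : (n / 2) * (n / (2 * k)) ≤ #(arithProgs k n) := by
    refine le_trans (le_of_eq ?_) (card_le_card hsub)
    rw [card_image_of_injOn hinj, card_product, Nat.card_Icc, Nat.card_Icc]
    simp
  have h2 : n ≤ 4 * (n / 2) := by omega
  have h3 : n ≤ 4 * k * (n / (2 * k)) := by
    have h4 := Nat.lt_mul_div_succ n (show 0 < 2 * k by omega)
    have h5 : 1 ≤ n / (2 * k) := (Nat.one_le_div_iff (by omega)).2 hn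
    nlinarith
  have h6 : n ^ 2 ≤ 16 * k * #(arithProgs k n) := by
    calc n ^ 2 = n * n := sq n
      _ ≤ (4 * (n / 2)) * (4 * k * (n / (2 * k))) := Nat.mul_le_mul h2 h3
      _ = 16 * k * ((n / 2) * (n / (2 * k))) := by ring
      _ ≤ _ := Nat.mul_le_mul_left _ h1
  exact_mod_cast h6

lemma boundedCodegree_arithProgs (hk : 2 ≤ k) :
    BoundedCodegree (arithProgs k n) (Icc 1 n) k (k ^ 2) (k * n) where
  subset f hf := (mem_arithProgs.1 hf).1
  card f hf := by
    obtain ⟨-, a, d, hd, rfl⟩ := mem_arithProgs.1 hf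
    rw [card_image_of_injective, card_range]
    intro i j hij
    simp only [Nat.add_left_cancel_iff] at hij
    exact Nat.eq_of_mul_eq_mul_right hd hij
  degree v := by
    have hsub : {f ∈ arithProgs k n | v ∈ f} ⊆ (range k ×ˢ Icc 1 n).image
        fun x : ℕ × ℕ => (range k).image (fun j => (v - x.1 * x.2) + j * x.2) := by
      intro f hf
      obtain ⟨hf, hv⟩ := mem_filter.1 hf
      obtain ⟨a, ha, d, hd, rfl⟩ := exists_of_mem_arithProgs hk hf
      obtain ⟨i, hi, rfl⟩ := mem_image.1 hv
      exact mem_image.2 ⟨(i, d), mem_product.2 ⟨hi, hd⟩, by simp⟩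
    refine (card_le_card hsub).trans (card_image_le.trans_eq ?_)
    simp
  codegree u v huv := by
    -- Two distinct points and their positions i, j determine the progression, with d = (v - u)/(j -
    -- i). On actual progressions the division is exact and the quotient positive, so the
    -- truncations are harmless.
    have hsub : {f ∈ arithProgs k n | u ∈ f ∧ v ∈ f} ⊆ (range k ×ˢ range k).image
        fun x : ℕ × ℕ => (range k).image fun l =>
          (u - x.1 * (((v : ℤ) - u) / ((x.2 : ℤ) - x.1)).toNat) +
            l * (((v : ℤ) - u) / ((x.2 : ℤ) - x.1)).toNat := by
      intro f hf
      obtain ⟨hf, hu, hv⟩ := mem_filter.1 hf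
      obtain ⟨a, ha, d, hd, rfl⟩ := exists_of_mem_arithProgs hk hf
      obtain ⟨i, hi, rfl⟩ := mem_image.1 hu
      obtain ⟨j, hj, rfl⟩ := mem_image.1 hv
      refine mem_image.2 ⟨(i, j), mem_product.2 ⟨hi, hj⟩, ?_⟩
      have hij : (j : ℤ) - i ≠ 0 := by
        intro h
        have : j = i := by omega
        exact huv (by rw [this])
      have hd' : ((((a + j * d : ℕ) : ℤ) - (a + i * d : ℕ)) / ((j : ℤ) - i)).toNat = d := by
        have : ((a + j * d : ℕ) : ℤ) - (a + i * d : ℕ) = ((j : ℤ) - i) * d := by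
          push_cast; ring
        rw [this, Int.mul_ediv_cancel_left _ hij, Int.toNat_natCast]
      simp only [hd', Nat.add_sub_cancel]
    refine (card_le_card hsub).trans (card_image_le.trans_eq ?_)
    simp [sq]

end ArithProgs

/-! ### The order of magnitude of the variance -/

section Variance

open Finset

/-- The variance of the number of `k`-term progressions in the binomial random subset of `[n]`. -/
noncomputable def apVar (k n : ℕ) (p : ℝ) : ℝ :=
  binExp (Icc 1 n) p
    (fun A => ((#(edgesIn (arithProgs k n) A) : ℝ) - #(arithProgs k n) * p ^ k) ^ 2)

variable {k n : ℕ} {p γ t : ℝ}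

lemma arithProgMean_eq (hk : 2 ≤ k) (p : unitInterval) :
    arithProgMean k n p = #(arithProgs k n) * (p : ℝ) ^ k := by
  rw [arithProgMean, randomSubset, ← coe_Icc, setBernoulli_integral_eq_binExp]
  simp_rw [arithProgCount_coe]
  exact binExp_card_edgesIn (boundedCodegree_arithProgs hk)

lemma arithProgVar_eq (hk : 2 ≤ k) (p : unitInterval) : arithProgVar k n p = apVar k n p := by
  rw [arithProgVar, randomSubset, ← coe_Icc, setBernoulli_variance_eq_binExp]
  simp_rw [arithProgCount_coe]
  rw [binExp_card_edgesIn (boundedCodegree_arithProgs hk), apVar]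

/-- The assumption np^{k-1} ≥ 1 gives p^k ≤ np^{2k-1}, so pairs sharing several points do not exceed
the order of those sharing one. -/
lemma apVar_le (hk : 2 ≤ k) (hp0 : 0 ≤ p) (hp1 : p ≤ 1) (hnp : 1 ≤ n * p ^ (k - 1)) :
    apVar k n p ≤ ((k : ℝ) ^ 2 + k ^ 4) * (n ^ 3 * p ^ (2 * k - 1)) := by
  have hH := boundedCodegree_arithProgs (n := n) hk
  have h1 := variance_upper_bound hH hp0 hp1
  have h2 : (#(arithProgs k n) : ℝ) ≤ n ^ 2 := by exact_mod_cast card_arithProgs_le hk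
  have h3 : p ^ (2 * k - 1) = p ^ k * p ^ (k - 1) := by rw [← pow_add]; congr 1; omega
  have h4 : p ^ k ≤ n * p ^ (2 * k - 1) := by
    have : 0 ≤ p ^ k := by positivity
    rw [h3]; nlinarith
  rw [apVar, binExp_sq_card_edgesIn_sub hH]
  refine h1.trans ?_
  push_cast
  calc (#(arithProgs k n) : ℝ) * (k * (k * n) * p ^ (2 * k - 1) + k ^ 2 * k ^ 2 * p ^ k)
      ≤ n ^ 2 * (k * (k * n) * p ^ (2 * k - 1) + k ^ 2 * k ^ 2 * (n * p ^ (2 * k - 1))) := by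
        gcongr
    _ = _ := by ring

lemma le_apVar (hk : 2 ≤ k) (hn : 2 * k ≤ n) (hp0 : 0 ≤ p) (hp1 : p ≤ 1) :
    (n ^ 3 * p ^ (2 * k - 1)) * (1 - p) ≤ 256 * k * apVar k n p := by
  have hH := boundedCodegree_arithProgs (n := n) hk
  have h1 := variance_lower_bound hH hp0 hp1 (by omega)
  rw [← binExp_sq_card_edgesIn_sub hH, Nat.card_Icc, Nat.add_sub_cancel] at h1
  change _ ≤ (n : ℝ) * apVar k n p at h1
  have h2 := le_card_arithProgs hk hn
  have hn0 : (0 : ℝ) < n := by exact_mod_cast (by omega : 0 < n)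
  have hk0 : (0 : ℝ) < k := by exact_mod_cast (by omega : 0 < k)
  have h3 : ((n : ℝ) ^ 2) ^ 2 ≤ (16 * k * #(arithProgs k n)) ^ 2 :=
    pow_le_pow_left₀ (by positivity) h2 2
  set q := p ^ (2 * k - 1) * (1 - p) with hq
  have hq0 : 0 ≤ q := mul_nonneg (by positivity) (by linarith)
  have h4 : (n : ℝ) * (n ^ 3 * q) ≤ n * (256 * k * apVar k n p) := by
    have h5 := mul_le_mul_of_nonneg_right h3 hq0
    nlinarith
  have h6 := le_of_mul_le_mul_left h4 hn0
  rw [hq] at h6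
  linarith

lemma le_card_arithProgs_mul (hk : 2 ≤ k) (hn : 2 * k ≤ n) (hp0 : 0 ≤ p) :
    (n : ℝ) ^ 2 * p ^ k ≤ 16 * k * (#(arithProgs k n) * p ^ k) := by
  have := mul_le_mul_of_nonneg_right (le_card_arithProgs hk hn) (pow_nonneg hp0 k)
  linarith

lemma one_le_cube_mul (hk : 2 ≤ k) (hp0 : 0 ≤ p) (hp1 : p ≤ 1)
    (hnp : 1 ≤ n * p ^ (k - 1)) : 1 ≤ (n : ℝ) ^ 3 * p ^ (2 * k - 1) := by
  have h1 : (n : ℝ) * p ^ (k - 1) ≤ n * p := by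
    refine mul_le_mul_of_nonneg_left ?_ (by positivity)
    exact (pow_le_pow_of_le_one hp0 hp1 (show 1 ≤ k - 1 by omega)).trans_eq (pow_one p)
  have h2 : (n : ℝ) ^ 3 * p ^ (2 * k - 1) = (n * p) * (n * p ^ (k - 1)) ^ 2 := by
    rw [show 2 * k - 1 = (k - 1) * 2 + 1 by omega, pow_succ p, pow_mul p]
    ring
  rw [h2]
  nlinarith

lemma apVar_pos (hk : 2 ≤ k) (hn : 2 * k ≤ n) (hp0 : 0 ≤ p) (hp1 : p < 1)
    (hnp : 1 ≤ n * p ^ (k - 1)) : 0 < apVar k n p := by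
  have h1 := le_apVar hk hn hp0 hp1.le
  have h2 := one_le_cube_mul hk hp0 hp1.le hnp
  have h3 : 0 < 256 * (k : ℝ) * apVar k n p :=
    lt_of_lt_of_le (mul_pos (by linarith) (by linarith)) h1
  exact pos_of_mul_pos_right h3 (by positivity)

lemma sq_mul_exp_neg_le (x : ℝ) {c : ℝ} (hc : 0 < c) (hx : 0 ≤ x) :
    x ^ 2 * Real.exp (-(c * x)) ≤ (2 / c) ^ 2 := by
  have h1 : x ≤ 2 / c * Real.exp (c * x / 2) := by
    have := Real.add_one_le_exp (c * x / 2)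
    rw [div_mul_eq_mul_div, le_div_iff₀ hc]
    linarith
  have h2 : x ^ 2 ≤ (2 / c * Real.exp (c * x / 2)) ^ 2 := pow_le_pow_left₀ hx h1 2
  rw [Real.exp_neg, ← div_eq_mul_inv, div_le_iff₀ (Real.exp_pos _)]
  refine h2.trans_eq ?_
  rw [mul_pow, ← Real.exp_nat_mul]
  congr 2
  push_cast
  ring

lemma exp_neg_log_one_div (hp : 0 < p) : Real.exp (-Real.log (1 / p)) = p := by
  rw [one_div, Real.log_inv, neg_neg, Real.exp_log hp]

lemma le_log_one_div (hp0 : 0 < p) (hp : p ≤ 1 - γ) : γ ≤ Real.log (1 / p) := by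
  rw [one_div, Real.log_inv]
  linarith [Real.log_le_sub_one_of_pos hp0]

end Variance

/-! ### Lower bound: tilting and planting -/

section LowerBound

open Finset

variable {k n : ℕ} {p γ t : ℝ}

/-- At density q, Chebyshev's inequality gives the event probability at least 1/2; `sq_binProb_le`
transfers its square to density p. -/
lemma quarter_le_binProb_mul_exp {q s m : ℝ} (hp0 : 0 < p) (hp1 : p < 1)
    (hq0 : 0 ≤ q) (hq1 : q ≤ 1) (hs : 0 < s) (hmean : m + s ≤ #(arithProgs k n) * q ^ k)
    (hvar : 2 * apVar k n q ≤ s ^ 2) :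
    1 / 4 ≤ binProb (Icc 1 n) p (fun A => m ≤ #(edgesIn (arithProgs k n) A)) *
      Real.exp (n * ((q - p) ^ 2 / (p * (1 - p)))) := by
  have hcs := sq_binProb_le (V := Icc 1 n) hp0 hp1 (q := q)
    (P := fun A => m ≤ #(edgesIn (arithProgs k n) A))
  rw [Nat.card_Icc, Nat.add_sub_cancel] at hcs
  refine le_trans ?_ hcs
  have h1 := binProb_abs_ge_le (V := Icc 1 n) (p := q) (s := s)
    (g := fun A => (#(edgesIn (arithProgs k n) A) : ℝ))
    (m := #(arithProgs k n) * q ^ k) hq0 hq1 hs.le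
  have h2 : binProb (Icc 1 n) q (fun A => ¬ m ≤ #(edgesIn (arithProgs k n) A)) ≤
      binProb (Icc 1 n) q
        (fun A => s ≤ |(#(edgesIn (arithProgs k n) A) : ℝ) - #(arithProgs k n) * q ^ k|) :=
    binProb_mono hq0 hq1 fun A _ hA => by
      rw [not_le] at hA
      rw [abs_sub_comm]
      exact le_trans (by linarith) (le_abs_self _)
  change _ ≤ apVar k n q at h1
  rw [binProb_compl] at h2
  have hs2 : 0 < s ^ 2 := by positivity
  have h3 : binProb (Icc 1 n) q
      (fun A => s ≤ |(#(edgesIn (arithProgs k n) A) : ℝ) - #(arithProgs k n) * q ^ k|) ≤ 1 / 2 := by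
    refine le_of_mul_le_mul_right ?_ hs2
    linarith
  nlinarith

/-- Used with V = n³p^{2k-1} and W the variance. Since npV is of order μ², the cost np(Bt/μ)² is of
order t²/V. -/
lemma tilting_exponent_le {n p q t W γ A B K V μ : ℝ} (hn : 0 < n) (hp0 : 0 < p) (hγ : 0 < γ)
    (hpγ : p ≤ 1 - γ) (hW0 : 0 < W) (hμ0 : 0 < μ) (hA : 0 < A)
    (hq : q = p * (1 + B * t / μ)) (hWV : W ≤ A * V) (hVμ : n * p * V ≤ K * μ ^ 2) :
    n * ((q - p) ^ 2 / (p * (1 - p))) ≤ K * A * B ^ 2 / γ * (t ^ 2 / W) := by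
  have h1p : 0 < 1 - p := by linarith
  have h1 : (q - p) ^ 2 / (p * (1 - p)) = p * (B * t / μ) ^ 2 / (1 - p) := by
    rw [hq]; field_simp; ring
  have h2 : p * (B * t / μ) ^ 2 / (1 - p) ≤ p * (B * t / μ) ^ 2 / γ := by
    gcongr
    linarith
  have h3 : n * p * W ≤ A * (K * μ ^ 2) := by
    calc n * p * W ≤ n * p * (A * V) := by gcongr
      _ = A * (n * p * V) := by ring
      _ ≤ _ := by gcongr
  rw [h1]
  calc n * (p * (B * t / μ) ^ 2 / (1 - p)) ≤ n * (p * (B * t / μ) ^ 2 / γ) := by gcongr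
    _ = (n * p * W) * (B ^ 2 * t ^ 2 / (γ * W * μ ^ 2)) := by field_simp
    _ ≤ (A * (K * μ ^ 2)) * (B ^ 2 * t ^ 2 / (γ * W * μ ^ 2)) := by gcongr
    _ = _ := by field_simp

lemma exp_neg_two_le : Real.exp (-2) ≤ 1 / 4 := by
  have h6 : Real.exp (-2) = (Real.exp 1)⁻¹ ^ 2 := by
    rw [← Real.exp_neg, ← Real.exp_nat_mul]; norm_num
  have h7 : (Real.exp 1)⁻¹ ≤ 1 / 2 := by
    rw [one_div]
    exact inv_anti₀ (by norm_num) (by linarith [Real.add_one_le_exp (1 : ℝ)])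
  rw [h6]
  exact (pow_le_pow_left₀ (by positivity) h7 2).trans (by norm_num)

/-- Lower bound for moderate deviations, from raising the density slightly. -/
lemma tilting_lower_bound (hk : 2 ≤ k) (hγ0 : 0 < γ) (hγ1 : γ < 1) :
    ∃ c C : ℝ, 0 < c ∧ 0 < C ∧ ∀ (n : ℕ) (p t : ℝ), 2 * k ≤ n → 0 < p → p ≤ 1 - γ →
      1 ≤ n * p ^ (k - 1) → 0 < t → apVar k n p ≤ t ^ 2 →
      t ≤ c * (#(arithProgs k n) * p ^ k) →
      Real.exp (-(C * (t ^ 2 / apVar k n p))) ≤ binProb (Icc 1 n) p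
        (fun A => #(arithProgs k n) * p ^ k + t ≤ #(edgesIn (arithProgs k n) A)) := by
  have hk0 : (0 : ℝ) < k := by exact_mod_cast (by omega : 0 < k)
  have hk2 : (2 : ℝ) ≤ k := by exact_mod_cast hk
  obtain ⟨A₁, hA₁⟩ : ∃ x : ℝ, x = (k : ℝ) ^ 2 + k ^ 4 := ⟨_, rfl⟩
  have hA₁0 : 0 < A₁ := by rw [hA₁]; positivity
  obtain ⟨A₂, hA₂⟩ : ∃ x : ℝ, x = A₁ * 2 ^ (2 * k - 1) * (256 * k / γ) := ⟨_, rfl⟩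
  have hA₂0 : 0 < A₂ := by rw [hA₂]; positivity
  -- The mean at density q exceeds μ by at least kBt ≥ 2Bt = t + (1 + 2A₂)t, and the surplus (1 +
  -- 2A₂)t beats the variance bound A₂t² there.
  obtain ⟨B, hB⟩ : ∃ x : ℝ, x = 1 + A₂ := ⟨_, rfl⟩
  have hB0 : 0 < B := by rw [hB]; positivity
  -- The choice γ/B forces δ ≤ γ, so q ≤ (1-γ)(1+γ) ≤ 1. The extra 2 absorbs the factor 1/4, since
  -- t²/Var X ≥ 1.
  refine ⟨γ / B, 256 * k ^ 2 * A₁ * B ^ 2 / γ + 2, by positivity, by positivity, ?_⟩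
  intro n p t hn hp0 hpγ hnp ht hvt htμ
  have hp1 : p < 1 := by linarith
  have hn0 : (0 : ℝ) < n := by exact_mod_cast (by omega : 0 < n)
  have hμn := le_card_arithProgs_mul hk hn hp0.le
  have hW0 : 0 < apVar k n p := apVar_pos hk hn hp0.le hp1 hnp
  have hV := apVar_le hk hp0.le hp1.le hnp
  rw [← hA₁] at hV
  have hμ0 : 0 < #(arithProgs k n) * p ^ k := by
    have h0 : 0 < (n : ℝ) ^ 2 * p ^ k := by positivity
    exact pos_of_mul_pos_right (h0.trans_le hμn) (by positivity)
  obtain ⟨μ, hμ⟩ : ∃ x : ℝ, x = #(arithProgs k n) * p ^ k := ⟨_, rfl⟩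
  rw [← hμ] at hμn hμ0 htμ ⊢
  obtain ⟨δ, hδ⟩ : ∃ x : ℝ, x = B * t / μ := ⟨_, rfl⟩
  have hδ0 : 0 < δ := by rw [hδ]; positivity
  have hδμ : δ * μ = B * t := by rw [hδ]; exact div_mul_cancel₀ _ hμ0.ne'
  have hδγ : δ ≤ γ := by
    have h1 : γ / B * B = γ := div_mul_cancel₀ _ hB0.ne'
    rw [hδ, div_le_iff₀ hμ0]
    calc B * t ≤ B * (γ / B * μ) := by gcongr
      _ = (γ / B * B) * μ := by ring
      _ = γ * μ := by rw [h1]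
  obtain ⟨q, hq⟩ : ∃ x : ℝ, x = p * (1 + δ) := ⟨_, rfl⟩
  have hq0 : 0 < q := by rw [hq]; positivity
  have hpq : p ≤ q := by rw [hq]; nlinarith
  have hq1 : q ≤ 1 := by rw [hq]; nlinarith
  have hV' : n ^ 3 * p ^ (2 * k - 1) ≤ 256 * k / γ * apVar k n p := by
    have h1 := le_apVar hk hn hp0.le hp1.le
    rw [div_mul_eq_mul_div, le_div_iff₀ hγ0]
    refine le_trans ?_ h1
    gcongr
    linarith
  have hWq : apVar k n q ≤ A₂ * t ^ 2 := by
    have h1 : apVar k n q ≤ A₁ * (n ^ 3 * q ^ (2 * k - 1)) := by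
      rw [hA₁]
      exact apVar_le hk hq0.le hq1 (hnp.trans (by gcongr))
    have h2 : q ^ (2 * k - 1) ≤ 2 ^ (2 * k - 1) * p ^ (2 * k - 1) := by
      rw [← mul_pow]
      refine pow_le_pow_left₀ hq0.le ?_ _
      rw [hq]; nlinarith
    calc apVar k n q ≤ A₁ * (n ^ 3 * (2 ^ (2 * k - 1) * p ^ (2 * k - 1))) := by
          refine h1.trans ?_; gcongr
      _ = A₁ * 2 ^ (2 * k - 1) * (n ^ 3 * p ^ (2 * k - 1)) := by ring
      _ ≤ A₁ * 2 ^ (2 * k - 1) * (256 * k / γ * apVar k n p) := by gcongr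
      _ = A₂ * apVar k n p := by rw [hA₂]; ring
      _ ≤ _ := by gcongr
  have hmean : μ + t + (1 + 2 * A₂) * t ≤ #(arithProgs k n) * q ^ k := by
    have h1 : 1 + (k : ℝ) * δ ≤ (1 + δ) ^ k := one_add_mul_le_pow (by linarith) k
    have h2 : 2 * (B * t) ≤ k * (B * t) := by gcongr
    calc μ + t + (1 + 2 * A₂) * t = μ + 2 * (B * t) := by rw [hB]; ring
      _ ≤ μ + k * (δ * μ) := by rw [hδμ]; linarith
      _ = μ * (1 + k * δ) := by ring
      _ ≤ μ * (1 + δ) ^ k := by gcongr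
      _ = _ := by rw [hq, mul_pow, hμ]; ring
  have hmain := quarter_le_binProb_mul_exp hp0 hp1 hq0.le hq1
    (s := (1 + 2 * A₂) * t) (by positivity) hmean (by
      have h1 : 0 < t ^ 2 := by positivity
      nlinarith [mul_pos hA₂0 h1, mul_pos (mul_pos hA₂0 hA₂0) h1])
  have hY : (n : ℝ) * ((q - p) ^ 2 / (p * (1 - p))) ≤
      256 * k ^ 2 * A₁ * B ^ 2 / γ * (t ^ 2 / apVar k n p) := by
    refine tilting_exponent_le hn0 hp0 hγ0 hpγ hW0 hμ0 hA₁0 (hδ ▸ hq) hV ?_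
    have h4 := pow_le_pow_left₀ (by positivity) hμn 2
    have h5 : ((n : ℝ) ^ 2 * p ^ k) ^ 2 = n * p * (n ^ 3 * p ^ (2 * k - 1)) := by
      have : p ^ (2 * k) = p * p ^ (2 * k - 1) := by rw [← pow_succ']; congr 1; omega
      rw [mul_pow, ← pow_mul p, mul_comm k 2, this]
      ring
    rw [h5] at h4
    exact h4.trans_eq (by ring)
  have hr : 1 ≤ t ^ 2 / apVar k n p := by rwa [le_div_iff₀ hW0, one_mul]
  have h4 : Real.exp (-(2 * (t ^ 2 / apVar k n p))) ≤ 1 / 4 := by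
    refine le_trans ?_ exp_neg_two_le
    rw [Real.exp_le_exp]; linarith
  have h8 := h4.trans (hmain.trans (mul_le_mul_of_nonneg_left
      (Real.exp_le_exp.2 hY) (binProb_nonneg hp0.le hp1.le)))
  rw [add_mul, neg_add, Real.exp_add,
    Real.exp_neg (256 * k ^ 2 * A₁ * B ^ 2 / γ * (t ^ 2 / apVar k n p)),
    mul_comm, ← div_eq_mul_inv, div_le_iff₀ (Real.exp_pos _)]
  exact h8

lemma BoundedCodegree.mono {H : Finset (Finset ℕ)} {V V' : Finset ℕ} {D Δ : ℕ}
    (hH : BoundedCodegree H V k D Δ) (hV : V ⊆ V') : BoundedCodegree H V' k D Δ :=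
  ⟨fun f hf => (hH.subset f hf).trans hV, hH.card, hH.degree, hH.codegree⟩

lemma card_add_card_le_card_edgesIn_union {m : ℕ} (hmn : m ≤ n) (A : Finset ℕ) :
    #(edgesIn (arithProgs k n) A) + #(arithProgs k m) ≤
      #(edgesIn (arithProgs k n) (A ∪ Icc 1 m)) + #(edgesIn (arithProgs k m) A) := by
  have h2 : edgesIn (arithProgs k n) A ∪ arithProgs k m ⊆
      edgesIn (arithProgs k n) (A ∪ Icc 1 m) := by
    rw [← edgesIn_arithProgs_Icc hmn]
    exact union_subset (edgesIn_mono subset_union_left) (edgesIn_mono subset_union_right)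
  have h3 : edgesIn (arithProgs k n) A ∩ arithProgs k m ⊆ edgesIn (arithProgs k m) A := by
    intro f hf
    obtain ⟨hf1, hf2⟩ := mem_inter.1 hf
    exact mem_filter.2 ⟨hf2, (mem_filter.1 hf1).2⟩
  rw [← card_union_add_card_inter]
  exact Nat.add_le_add (card_le_card h2) (card_le_card h3)

/-- Once an initial interval with enough progressions is present, the deviation has probability
bounded from below. -/
lemma quarter_le_binProb_union (hk : 2 ≤ k) (hγ0 : 0 < γ) (hγ1 : γ < 1) {m : ℕ} (hmn : m ≤ n)
    (hp0 : 0 < p) (hpγ : p ≤ 1 - γ) (ht : 0 < t) (hvt : apVar k n p ≤ t ^ 2) {L : ℝ}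
    (hL : L * γ = 4) (he : (1 + L) * t ≤ γ / 2 * #(arithProgs k m)) :
    γ / 4 ≤ binProb (Icc 1 n) p (fun A =>
      #(arithProgs k n) * p ^ k + t ≤ #(edgesIn (arithProgs k n) (A ∪ Icc 1 m))) := by
  have hp1 : p ≤ 1 := by linarith
  have hHm := (boundedCodegree_arithProgs (n := m) hk).mono (Icc_subset_Icc_right hmn)
  have hL4 : 4 ≤ L := by nlinarith
  have hpk : p ^ k ≤ 1 - γ :=
    ((pow_le_pow_of_le_one hp0.le hp1 (show 1 ≤ k by omega)).trans_eq (pow_one p)).trans hpγ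
  have hpk0 : 0 < p ^ k := by positivity
  -- Markov's inequality: with probability at least γ/2, less than a fraction (1 + p^k)/2 of the
  -- progressions in [m] is already present, so planting [m] gains at least (1 + L)t. Chebyshev's
  -- inequality limits the shortfall of the original count to Lt outside probability γ/16.
  have hmark := binProb_mul_le (V := Icc 1 n) (p := p)
    (g := fun A => (#(edgesIn (arithProgs k m) A) : ℝ))
    (P := fun A => (1 + p ^ k) / 2 * #(arithProgs k m) ≤ #(edgesIn (arithProgs k m) A))
    hp0.le hp1 (fun _ _ => by positivity) (fun _ _ h => h)
  rw [binExp_card_edgesIn hHm] at hmark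
  have hcheb := binProb_abs_ge_le (V := Icc 1 n) (p := p)
    (g := fun A => (#(edgesIn (arithProgs k n) A) : ℝ)) (m := #(arithProgs k n) * p ^ k) hp0.le hp1
    (s := L * t) (by positivity)
  change _ ≤ apVar k n p at hcheb
  have hcard := card_add_card_le_card_edgesIn_union (k := k) hmn
  generalize (#(arithProgs k n) * p ^ k : ℝ) = μ at hcheb ⊢
  generalize #(arithProgs k m) = e at he hmark hcard
  generalize p ^ k = x at hpk hpk0 hmark
  have he0 : (0 : ℝ) < e := by
    have : 0 < γ / 2 * (e : ℝ) := lt_of_lt_of_le (by positivity) he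
    exact pos_of_mul_pos_right this (by positivity)
  have hsub : ∀ A ⊆ Icc 1 n, ¬ (μ + t ≤ #(edgesIn (arithProgs k n) (A ∪ Icc 1 m))) →
      L * t ≤ |(#(edgesIn (arithProgs k n) A) : ℝ) - μ| ∨
      (1 + x) / 2 * e ≤ #(edgesIn (arithProgs k m) A) := by
    intro A _ hA
    by_contra hcon
    push Not at hcon
    apply hA
    have h1 := (abs_lt.1 hcon.1).1
    have h5 : (#(edgesIn (arithProgs k n) A) : ℝ) + e ≤
        #(edgesIn (arithProgs k n) (A ∪ Icc 1 m)) + #(edgesIn (arithProgs k m) A) := by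
      exact_mod_cast hcard A
    have h6 : γ / 2 * e ≤ (1 - x) / 2 * e := by gcongr; linarith
    linarith [hcon.2]
  have hbad := (binProb_mono hp0.le hp1 hsub).trans (binProb_or_le hp0.le hp1)
  rw [binProb_compl] at hbad
  have hb1 : binProb (Icc 1 n) p
      (fun A => L * t ≤ |(#(edgesIn (arithProgs k n) A) : ℝ) - μ|) ≤ γ / 16 := by
    have h2 : t ^ 2 ≤ γ / 16 * (L * t) ^ 2 := by
      have : γ / 16 * (L * t) ^ 2 = L / 4 * t ^ 2 := by linear_combination L * t ^ 2 / 16 * hL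
      rw [this]
      nlinarith [sq_nonneg t]
    exact le_of_mul_le_mul_right (hcheb.trans (hvt.trans h2)) (by positivity)
  have hb2 : binProb (Icc 1 n) p
      (fun A => (1 + x) / 2 * e ≤ #(edgesIn (arithProgs k m) A)) ≤ 1 - γ / 2 := by
    have h2 : e * x ≤ (1 - γ / 2) * ((1 + x) / 2 * e) := by
      have h3 : x ≤ (1 - γ / 2) * ((1 + x) / 2) := by nlinarith
      calc e * x = x * e := mul_comm _ _
        _ ≤ (1 - γ / 2) * ((1 + x) / 2) * e := by gcongr
        _ = _ := by ring
    exact le_of_mul_le_mul_right (hmark.trans h2) (by positivity)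
  linarith

/-- Lower bound for all deviations, from containing an initial interval. -/
lemma planting_lower_bound (hk : 2 ≤ k) (hγ0 : 0 < γ) (hγ1 : γ < 1) :
    ∃ C : ℝ, 0 < C ∧ ∀ (n : ℕ) (p t : ℝ), 2 * k ≤ n → 0 < p → p ≤ 1 - γ →
      1 ≤ n * p ^ (k - 1) → 0 < t → apVar k n p ≤ t ^ 2 →
      #(arithProgs k n) * p ^ k + t ≤ #(arithProgs k n) →
      Real.exp (-(C * (√t * Real.log (1 / p)))) ≤ binProb (Icc 1 n) p
        (fun A => #(arithProgs k n) * p ^ k + t ≤ #(edgesIn (arithProgs k n) A)) := by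
  have hk0 : (0 : ℝ) < k := by exact_mod_cast (by omega : 0 < k)
  have hk2 : (2 : ℝ) ≤ k := by exact_mod_cast hk
  -- A lower bound for √t, because t² ≥ Var X ≥ γ/(256k).
  obtain ⟨τ, hτ⟩ : ∃ x : ℝ, x = √(√(γ / (256 * k))) := ⟨_, rfl⟩
  have hτ0 : 0 < τ := by rw [hτ]; positivity
  obtain ⟨L, hL⟩ : ∃ x : ℝ, x = 4 / γ := ⟨_, rfl⟩
  have hL0 : 0 < L := by rw [hL]; positivity
  have hLγ : L * γ = 4 := by rw [hL]; exact div_mul_cancel₀ _ hγ0.ne'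
  -- The first term ensures m ≥ 2k for m = ⌈B√t⌉; the second gives [m] enough progressions for
  -- `quarter_le_binProb_union`.
  obtain ⟨B, hB⟩ : ∃ x : ℝ, x = 2 * k / τ + (32 * k * (1 + L) / γ + 1) := ⟨_, rfl⟩
  have hB2 : 0 < 2 * k / τ := by positivity
  have hB3 : 0 < 32 * k * (1 + L) / γ := by positivity
  have hB0 : 0 < B := by rw [hB]; positivity
  have hB1 : 32 * k * (1 + L) ≤ B ^ 2 * γ := by
    rw [← div_le_iff₀ hγ0]
    nlinarith
  have hBτ : 2 * k ≤ B * τ := by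
    rw [← div_le_iff₀ hτ0]; linarith
  have hlog : 0 < Real.log L := Real.log_pos (by nlinarith)
  -- The second summand absorbs the factor γ/4 = 1/L, since √t·log(1/p) ≥ τγ.
  refine ⟨2 * B + Real.log L / (τ * γ), by positivity, ?_⟩
  intro n p t hn hp0 hpγ hnp ht hvt hmax
  have hp1 : p < 1 := by linarith
  have hτt : τ ≤ √t := by
    rw [hτ]
    refine Real.sqrt_le_sqrt ((Real.sqrt_le_left ht.le).2 (le_trans ?_ hvt))
    rw [div_le_iff₀ (by positivity)]
    have h1 := le_apVar hk hn hp0.le hp1.le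
    have h2 := one_le_cube_mul hk hp0.le hp1.le hnp
    nlinarith
  have hsq : √t ^ 2 = t := Real.sq_sqrt ht.le
  have hst : 0 < √t := hτ0.trans_le hτt
  have hBt : 2 * k ≤ B * √t := hBτ.trans (by gcongr)
  obtain ⟨m, hm⟩ : ∃ x : ℕ, x = ⌈B * √t⌉₊ := ⟨_, rfl⟩
  have hm1 : B * √t ≤ m := hm ▸ Nat.le_ceil _
  have hm2 : (m : ℝ) ≤ 2 * B * √t := by
    have := (Nat.ceil_lt_add_one (show 0 ≤ B * √t by positivity)).le
    rw [← hm] at this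
    linarith
  have hmk : 2 * k ≤ m := by exact_mod_cast hBt.trans hm1
  have hlamγ : γ ≤ Real.log (1 / p) := le_log_one_div hp0 hpγ
  have hpm : Real.exp (-(2 * B * (√t * Real.log (1 / p)))) ≤ p ^ m := by
    nth_rw 2 [← exp_neg_log_one_div hp0]
    rw [← Real.exp_nat_mul, Real.exp_le_exp]
    nlinarith
  have hconst : Real.exp (-(Real.log L / (τ * γ) * (√t * Real.log (1 / p)))) ≤ γ / 4 := by
    have h1 : Real.exp (-Real.log L) = γ / 4 := by
      rw [Real.exp_neg, Real.exp_log hL0, hL, inv_div]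
    have h2 : Real.log L / (τ * γ) * (τ * γ) = Real.log L :=
      div_mul_cancel₀ _ (mul_pos hτ0 hγ0).ne'
    rw [← h1, Real.exp_le_exp, neg_le_neg_iff]
    calc Real.log L = Real.log L / (τ * γ) * (τ * γ) := h2.symm
      _ ≤ _ := by gcongr
  have hgoal : p ^ m * (γ / 4) ≤ binProb (Icc 1 n) p
      (fun A => #(arithProgs k n) * p ^ k + t ≤ #(edgesIn (arithProgs k n) A)) := by
    rcases le_or_gt m n with hmn | hmn
    · have he1 : (1 + L) * t ≤ γ / 2 * #(arithProgs k m) := by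
        have h1 := le_card_arithProgs hk hmk
        have h2 : B ^ 2 * t ≤ m ^ 2 := by
          rw [← hsq, ← mul_pow]
          exact pow_le_pow_left₀ (by positivity) hm1 2
        have h3 : (16 * k) * (2 * ((1 + L) * t)) ≤ (16 * k) * (γ * #(arithProgs k m)) := by
          calc (16 * k) * (2 * ((1 + L) * t)) = (32 * k * (1 + L)) * t := by ring
            _ ≤ B ^ 2 * γ * t := by gcongr
            _ = γ * (B ^ 2 * t) := by ring
            _ ≤ γ * (16 * k * #(arithProgs k m)) := by
              exact mul_le_mul_of_nonneg_left (h2.trans h1) hγ0.le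
            _ = _ := by ring
        have h4 := le_of_mul_le_mul_left h3 (by positivity)
        linarith
      have hplant := pow_mul_binExp_union_le (V := Icc 1 n) (p := p) hp0.le hp1.le
        (g := fun A => by
          classical
          exact if #(arithProgs k n) * p ^ k + t ≤ #(edgesIn (arithProgs k n) A) then 1 else 0)
        (fun A => by split_ifs <;> norm_num) (Icc_subset_Icc_right hmn)
      rw [Nat.card_Icc, Nat.add_sub_cancel] at hplant
      refine le_trans (mul_le_mul_of_nonneg_left ?_ (by positivity)) hplant
      exact quarter_le_binProb_union hk hγ0 hγ1 hmn hp0 hpγ ht hvt hLγ he1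
    -- If m exceeds n, the whole of [n] is planted, at the smaller cost p^n ≥ p^m.
    · have h1 : p ^ n ≤ binProb (Icc 1 n) p
          (fun A => #(arithProgs k n) * p ^ k + t ≤ #(edgesIn (arithProgs k n) A)) := by
        have h2 := binProb_superset (V := Icc 1 n) (p := p) (Subset.refl _)
        rw [Nat.card_Icc, Nat.add_sub_cancel] at h2
        rw [← h2]
        refine binProb_mono hp0.le hp1.le fun A _ hA => hmax.trans ?_
        have h3 := card_le_card (edgesIn_mono (H := arithProgs k n) hA)
        rw [edgesIn_arithProgs_Icc le_rfl] at h3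
        exact_mod_cast h3
      have h2 : p ^ m ≤ p ^ n := pow_le_pow_of_le_one hp0.le hp1.le hmn.le
      have h3 : 0 < p ^ m := by positivity
      refine le_trans ?_ (h2.trans h1)
      exact mul_le_of_le_one_right h3.le (by linarith)
  refine le_trans ?_ hgoal
  rw [add_mul, neg_add, Real.exp_add]
  exact mul_le_mul hpm hconst (Real.exp_pos _).le (by positivity)

/-- For deviations of the order of the mean the logarithmic term of the rate dominates. -/
lemma sqrt_mul_log_le (hk : 3 ≤ k) {c : ℝ} (hc : 0 < c) :
    ∃ A : ℝ, 0 < A ∧ ∀ (n : ℕ) (p t : ℝ), 2 * k ≤ n → 0 < p → p < 1 →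
      1 ≤ n * p ^ (k - 1) → c * (#(arithProgs k n) * p ^ k) ≤ t →
      √t * Real.log (1 / p) ≤ A * (t ^ 2 / apVar k n p) := by
  have hk0 : (0 : ℝ) < k := by exact_mod_cast (by omega : 0 < k)
  obtain ⟨A₁, hA₁⟩ : ∃ x : ℝ, x = (k : ℝ) ^ 2 + k ^ 4 := ⟨_, rfl⟩
  have hA₁0 : 0 < A₁ := by rw [hA₁]; positivity
  obtain ⟨c₁, hc₁⟩ : ∃ x : ℝ, x = c / (16 * k) := ⟨_, rfl⟩
  have hc₁0 : 0 < c₁ := by rw [hc₁]; positivity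
  have hc₁k : c₁ * (16 * k) = c := by rw [hc₁]; exact div_mul_cancel₀ _ (by positivity)
  refine ⟨√(4 * A₁ ^ 2 / c₁ ^ 3), by positivity, ?_⟩
  intro n p t hn hp0 hp1 hnp ht
  obtain ⟨A, hA⟩ : ∃ x : ℝ, x = √(4 * A₁ ^ 2 / c₁ ^ 3) := ⟨_, rfl⟩
  rw [← hA]
  have hA2 : A ^ 2 = 4 * A₁ ^ 2 / c₁ ^ 3 := by rw [hA]; exact Real.sq_sqrt (by positivity)
  have hA0 : 0 < A := by rw [hA]; positivity
  have hW0 := apVar_pos (by omega) hn hp0.le hp1 hnp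
  have hW := apVar_le (by omega) hp0.le hp1.le hnp
  rw [← hA₁] at hW
  have hlam0 : 0 ≤ Real.log (1 / p) := Real.log_nonneg (by rw [le_div_iff₀ hp0]; linarith)
  have hlp0 := sq_mul_exp_neg_le _ one_pos hlam0
  rw [one_mul, exp_neg_log_one_div hp0] at hlp0
  generalize apVar k n p = W at hW0 hW ⊢
  generalize Real.log (1 / p) = lam at hlam0 hlp0 ⊢
  have hn0 : (0 : ℝ) < n := by exact_mod_cast (by omega : 0 < n)
  have ht1 : c₁ * (n ^ 2 * p ^ k) ≤ t := by
    have h1 := le_card_arithProgs_mul (k := k) (by omega) hn hp0.le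
    have h2 : c₁ * (n ^ 2 * p ^ k) ≤ c₁ * (16 * k * (#(arithProgs k n) * p ^ k)) := by gcongr
    refine h2.trans (le_trans (le_of_eq ?_) ht)
    rw [← hc₁k]; ring
  have ht0 : 0 < t := lt_of_lt_of_le (by positivity) ht1
  have hsq : √t ^ 2 = t := Real.sq_sqrt ht0.le
  -- Here k ≥ 3 matters: one spare power of p absorbs the squared logarithm.
  have hlp : lam ^ 2 * p ^ (k - 2) ≤ 4 := by
    have h2 : p ^ (k - 2) ≤ p :=
      (pow_le_pow_of_le_one hp0.le hp1.le (show 1 ≤ k - 2 by omega)).trans_eq (pow_one p)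
    calc lam ^ 2 * p ^ (k - 2) ≤ lam ^ 2 * p := by gcongr
      _ ≤ 4 := by linarith
  have hc₁A : 4 * A₁ ^ 2 / c₁ ^ 3 * c₁ ^ 3 = 4 * A₁ ^ 2 := div_mul_cancel₀ _ (by positivity)
  have h6 : (lam * W) ^ 2 ≤ (A * √t ^ 3) ^ 2 := by
    have e1 : (n : ℝ) ^ 6 * p ^ (4 * k - 2) = (n ^ 2 * p ^ k) ^ 3 * p ^ (k - 2) := by
      rw [mul_pow, ← pow_mul, ← pow_mul, mul_assoc, ← pow_add]
      congr 2
      omega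
    calc (lam * W) ^ 2 ≤ (lam * (A₁ * (n ^ 3 * p ^ (2 * k - 1)))) ^ 2 := by gcongr
      _ = lam ^ 2 * A₁ ^ 2 * (n ^ 6 * p ^ (4 * k - 2)) := by
        rw [mul_pow, mul_pow, mul_pow, ← pow_mul p,
          show (2 * k - 1) * 2 = 4 * k - 2 by omega]
        ring
      _ = (lam ^ 2 * p ^ (k - 2)) * (A₁ ^ 2 * (n ^ 2 * p ^ k) ^ 3) := by rw [e1]; ring
      _ ≤ 4 * (A₁ ^ 2 * (n ^ 2 * p ^ k) ^ 3) := by gcongr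
      _ = (4 * A₁ ^ 2) * (n ^ 2 * p ^ k) ^ 3 := by ring
      _ = 4 * A₁ ^ 2 / c₁ ^ 3 * (c₁ * (n ^ 2 * p ^ k)) ^ 3 := by
        linear_combination (-((n : ℝ) ^ 2 * p ^ k) ^ 3) * hc₁A
      _ ≤ 4 * A₁ ^ 2 / c₁ ^ 3 * t ^ 3 := by gcongr
      _ = _ := by rw [mul_pow, ← pow_mul, mul_comm 3 2, pow_mul, hsq, hA2]
  have h7 : lam * W ≤ A * √t ^ 3 := le_of_sq_le_sq h6 (by positivity)
  have h8 : t ^ 2 = √t * √t ^ 3 := by rw [← hsq]; ring_nf; rw [hsq]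
  rw [← mul_div_assoc, le_div_iff₀ hW0, h8]
  nlinarith [Real.sqrt_nonneg t]

/-- The lower bound for the upper tail. -/
lemma upperTail_lower_bound (hk : 3 ≤ k) (hγ0 : 0 < γ) (hγ1 : γ < 1) :
    ∃ C : ℝ, 0 < C ∧ ∀ (n : ℕ) (p t : ℝ), 2 * k ≤ n → 0 < p → p ≤ 1 - γ →
      1 ≤ n * p ^ (k - 1) → 0 < t → apVar k n p ≤ t ^ 2 →
      #(arithProgs k n) * p ^ k + t ≤ #(arithProgs k n) →
      Real.exp (-(C * min (t ^ 2 / apVar k n p) (√t * Real.log (1 / p)))) ≤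
        binProb (Icc 1 n) p
          (fun A => #(arithProgs k n) * p ^ k + t ≤ #(edgesIn (arithProgs k n) A)) := by
  obtain ⟨c, C₁, hc, hC₁, h₁⟩ := tilting_lower_bound (k := k) (by omega) hγ0 hγ1
  obtain ⟨C₂, hC₂, h₂⟩ := planting_lower_bound (k := k) (by omega) hγ0 hγ1
  obtain ⟨A, hA, h₃⟩ := sqrt_mul_log_le hk hc
  refine ⟨C₁ + C₂ + C₂ * A, by positivity, ?_⟩
  intro n p t hn hp0 hpγ hnp ht hvt hmax
  have hp1 : p < 1 := by linarith
  have hW0 := apVar_pos (by omega) hn hp0.le hp1 hnp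
  have hr : 0 ≤ t ^ 2 / apVar k n p := by positivity
  have hl : 0 ≤ √t * Real.log (1 / p) :=
    mul_nonneg (Real.sqrt_nonneg t) (hγ0.le.trans (le_log_one_div hp0 hpγ))
  rcases min_cases (t ^ 2 / apVar k n p) (√t * Real.log (1 / p)) with ⟨h, -⟩ | ⟨h, -⟩ <;> rw [h]
  · rcases le_total t (c * (#(arithProgs k n) * p ^ k)) with htc | htc
    · refine le_trans ?_ (h₁ n p t hn hp0 hpγ hnp ht hvt htc)
      rw [Real.exp_le_exp, neg_le_neg_iff]
      refine mul_le_mul_of_nonneg_right ?_ hr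
      have : 0 < C₂ * A := by positivity
      linarith
    -- Even where t²/Var X is the minimum, planting serves for t ≥ cμ, the two terms then being
    -- comparable.
    · refine le_trans ?_ (h₂ n p t hn hp0 hpγ hnp ht hvt hmax)
      rw [Real.exp_le_exp, neg_le_neg_iff]
      have h4 := mul_le_mul_of_nonneg_left (h₃ n p t hn hp0 hp1 hnp htc) hC₂.le
      have h5 : 0 ≤ (C₁ + C₂) * (t ^ 2 / apVar k n p) := by positivity
      linarith
  · refine le_trans ?_ (h₂ n p t hn hp0 hpγ hnp ht hvt hmax)
    rw [Real.exp_le_exp, neg_le_neg_iff]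
    refine mul_le_mul_of_nonneg_right ?_ hl
    have : 0 < C₂ * A := by positivity
    linarith

end LowerBound

/-! ### Upper bound: heavy vertices and sparse families -/

section UpperBound

open Finset

variable {k n : ℕ} {p γ t : ℝ}

lemma choose_mul_pow_le (Δ : ℕ) {s : ℕ} (hs : 0 < s) {x : ℝ} (hx : 0 ≤ x) :
    (Δ.choose s : ℝ) * x ^ s ≤ (Real.exp 1 * Δ * x / s) ^ s := by
  have hs0 : (0 : ℝ) < s := by exact_mod_cast hs
  have h1 : (Δ.choose s : ℝ) ≤ Δ ^ s / s.factorial := Nat.choose_le_pow_div s Δ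
  have h2 : (s : ℝ) ^ s / s.factorial ≤ Real.exp 1 ^ s := by
    rw [← Real.exp_nat_mul, mul_one]
    exact Real.pow_div_factorial_le_exp _ hs0.le s
  have h3 : (1 : ℝ) / s.factorial ≤ (Real.exp 1 / s) ^ s := by
    rw [div_pow, le_div_iff₀ (by positivity), one_div, mul_comm, ← div_eq_mul_inv]
    exact h2
  calc (Δ.choose s : ℝ) * x ^ s ≤ Δ ^ s / s.factorial * x ^ s := by gcongr
    _ = (Δ * x) ^ s * (1 / s.factorial) := by rw [mul_pow]; ring
    _ ≤ (Δ * x) ^ s * (Real.exp 1 / s) ^ s := by gcongr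
    _ = _ := by rw [← mul_pow]; congr 1; ring

/-- The hypothesis on s makes the petals of one star cost e^{-2βs}. Half of that exponent pays for
the n possible centres, leaving e^{-βs} per star. -/
lemma binProb_hasStars_le_exp (hk : 2 ≤ k) (hn : 0 < n) (hp0 : 0 ≤ p) (hp1 : p ≤ 1) {s r : ℕ}
    (hs : 0 < s) {β L : ℝ}
    (h1 : Real.exp 1 * (k * (n * p ^ (k - 1))) ≤ s * Real.exp (-(2 * β)))
    (h2 : Real.log n ≤ β * s) (h3 : L ≤ r * (β * s)) :
    binProb (Icc 1 n) p (HasStars (arithProgs k n) s r ∅) ≤ Real.exp (-L) := by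
  have hs0 : (0 : ℝ) < s := by exact_mod_cast hs
  have hn0 : (0 : ℝ) < n := by exact_mod_cast hn
  have h := binProb_hasStars_le (boundedCodegree_arithProgs (n := n) hk) hp0 hp1 hs r
    (empty_subset _)
  simp only [empty_subset, true_and, card_empty, pow_zero, one_mul, Nat.card_Icc,
    Nat.add_sub_cancel] at h
  refine h.trans ?_
  have h4 : (n : ℝ) * (((k * n).choose s : ℕ) * p ^ ((k - 1) * s)) ≤ Real.exp (-(β * s)) := by
    have h5 := choose_mul_pow_le (k * n) hs (pow_nonneg hp0 (k - 1))
    have h6 : Real.exp 1 * ((k * n : ℕ) : ℝ) * p ^ (k - 1) / s ≤ Real.exp (-(2 * β)) := by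
      rw [div_le_iff₀ hs0, mul_comm (Real.exp (-(2 * β)))]
      refine le_trans (le_of_eq ?_) h1
      push_cast
      ring
    have h7 := h5.trans (pow_le_pow_left₀ (by positivity) h6 s)
    rw [← Real.exp_nat_mul, ← pow_mul] at h7
    calc (n : ℝ) * (((k * n).choose s : ℕ) * p ^ ((k - 1) * s))
        ≤ Real.exp (Real.log n) * Real.exp (s * -(2 * β)) := by
          rw [Real.exp_log hn0]; gcongr
      _ = Real.exp (Real.log n + s * -(2 * β)) := (Real.exp_add _ _).symm
      _ ≤ _ := by rw [Real.exp_le_exp]; linarith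
  refine (pow_le_pow_left₀ (by positivity) h4 r).trans ?_
  rw [← Real.exp_nat_mul, Real.exp_le_exp]
  linarith

/-- The total degree of the vertices of large degree is unlikely to be large. -/
lemma binProb_heavyDegree_le (hk : 2 ≤ k) (hn : 0 < n) (hp0 : 0 ≤ p) (hp1 : p ≤ 1)
    {s₀ s₁ s₂ : ℕ} {β L : ℝ} (hβ : 0 < β) (hL : 0 < L) (ht : 0 < t)
    (hs₀ : 0 < s₀) (hs₁ : 0 < s₁) (hs₂ : 0 < s₂)
    (h₀ : Real.exp 1 * (k * (n * p ^ (k - 1))) ≤ s₀ * Real.exp (-(2 * 1)))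
    (h₁ : Real.exp 1 * (k * (n * p ^ (k - 1))) ≤ s₁ * Real.exp (-(2 * β)))
    (h₂ : Real.exp 1 * (k * (n * p ^ (k - 1))) ≤ s₂ * Real.exp (-(2 * β)))
    (hl₀ : Real.log n ≤ s₀) (hl₁ : Real.log n ≤ β * s₁) (hl₂ : Real.log n ≤ β * s₂)
    (hL₂ : L ≤ β * s₂)
    (ht₁ : 16 * k ^ 5 * L * s₁ ≤ t) (ht₂ : 32 * k ^ 6 * L * s₂ ≤ t * β) :
    binProb (Icc 1 n) p (fun A =>
      t / 2 < heavyDegree (arithProgs k n) (Icc 1 n) A (2 * k ^ 3 * s₀)) ≤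
      3 * Real.exp (-L) := by
  have hH := boundedCodegree_arithProgs (n := n) hk
  have hk0 : (0 : ℝ) < k := by exact_mod_cast (by omega : 0 < k)
  have hs₀' : (0 : ℝ) < s₀ := by exact_mod_cast hs₀
  have hs₁' : (0 : ℝ) < s₁ := by exact_mod_cast hs₁
  have hs₂' : (0 : ℝ) < s₂ := by exact_mod_cast hs₂
  -- Then r + 1 stars are as unlikely as e^{-L}, while r stars still satisfy rβs ≤ L (with β = 1 for
  -- s₀), which keeps B small.
  obtain ⟨r₀, hr₀⟩ : ∃ r, r = ⌊L / s₀⌋₊ := ⟨_, rfl⟩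
  obtain ⟨r₁, hr₁⟩ : ∃ r, r = ⌊L / (β * s₁)⌋₊ := ⟨_, rfl⟩
  have hr₀l : (r₀ : ℝ) * s₀ ≤ L := by
    rw [← le_div_iff₀ hs₀', hr₀]; exact Nat.floor_le (by positivity)
  have hr₀u : L ≤ ((r₀ + 1 : ℕ) : ℝ) * (1 * s₀) := by
    rw [one_mul, ← div_le_iff₀ hs₀', hr₀]; push_cast; exact (Nat.lt_floor_add_one _).le
  have hr₁l : (r₁ : ℝ) * (β * s₁) ≤ L := by
    rw [← le_div_iff₀ (by positivity), hr₁]; exact Nat.floor_le (by positivity)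
  have hr₁u : L ≤ ((r₁ + 1 : ℕ) : ℝ) * (β * s₁) := by
    rw [← div_le_iff₀ (by positivity), hr₁]; push_cast; exact (Nat.lt_floor_add_one _).le
  have p₀ := binProb_hasStars_le_exp hk hn hp0 hp1 hs₀ (β := 1) h₀ (by rwa [one_mul]) hr₀u
  have p₁ := binProb_hasStars_le_exp hk hn hp0 hp1 hs₁ h₁ hl₁ hr₁u
  have p₂ := binProb_hasStars_le_exp hk hn hp0 hp1 hs₂ (r := 1) (L := L) h₂ hl₂
    (by rwa [Nat.cast_one, one_mul])
  have hsub : ∀ A ⊆ Icc 1 n,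
      t / 2 < heavyDegree (arithProgs k n) (Icc 1 n) A (2 * k ^ 3 * s₀) →
      HasStars (arithProgs k n) s₀ (r₀ + 1) ∅ A ∨
        (HasStars (arithProgs k n) s₁ (r₁ + 1) ∅ A ∨ HasStars (arithProgs k n) s₂ 1 ∅ A) := by
    intro A _ hA
    by_contra hcon
    push Not at hcon
    obtain ⟨c₀, c₁, c₂⟩ := hcon
    have hy₁ : 2 * ((k : ℝ) * (k ^ 2 : ℕ) * s₁) ≤ t / (8 * k ^ 2 * L) := by
      rw [le_div_iff₀ (by positivity)]
      push_cast
      linarith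
    have hy₂ : (k : ℝ) * (k ^ 2 : ℕ) * s₂ < t * β / (16 * k ^ 3 * L) := by
      rw [lt_div_iff₀ (by positivity)]
      push_cast
      have : 0 < 16 * (k : ℝ) ^ 6 * L * s₂ := by positivity
      linarith
    -- Thresholds 2k³s₀, t/(8k²L), tβ/(16k³L): each of the two passages contributes at most t/4, and
    -- nothing lies above the last one.
    have w₀ := heavyDegree_le_of_not_hasStars hH hk c₀ (y := 2 * k ^ 3 * s₀)
      (y' := t / (8 * k ^ 2 * L)) (by push_cast; exact le_of_eq (by ring)) (by positivity)
    have w₁ := heavyDegree_le_of_not_hasStars hH hk c₁ (y := t / (8 * k ^ 2 * L))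
      (y' := t * β / (16 * k ^ 3 * L)) hy₁ (by positivity)
    have w₂ := heavyDegree_eq_zero_of_not_hasStars hH hk c₂ hy₂
    rw [w₂, add_zero] at w₁
    have e₀ : 2 * (k * ((r₀ : ℝ) * (k * s₀) * (t / (8 * k ^ 2 * L)))) ≤ t / 4 := by
      calc 2 * (k * ((r₀ : ℝ) * (k * s₀) * (t / (8 * k ^ 2 * L))))
          = (r₀ * s₀) * (t / (4 * L)) := by field_simp; ring
        _ ≤ L * (t / (4 * L)) := by gcongr
        _ = t / 4 := by field_simp
    have e₁ : 2 * (k * (2 * (k * ((r₁ : ℝ) * (k * s₁) * (t * β / (16 * k ^ 3 * L)))))) ≤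
        t / 4 := by
      calc 2 * (k * (2 * (k * ((r₁ : ℝ) * (k * s₁) * (t * β / (16 * k ^ 3 * L))))))
          = (r₁ * (β * s₁)) * (t / (4 * L)) := by field_simp; ring
        _ ≤ L * (t / (4 * L)) := by gcongr
        _ = t / 4 := by field_simp
    have w₃ : 2 * ((k : ℝ) * heavyDegree (arithProgs k n) (Icc 1 n) A (t / (8 * k ^ 2 * L))) ≤
        2 * (k * (2 * (k * ((r₁ : ℝ) * (k * s₁) * (t * β / (16 * k ^ 3 * L)))))) := by gcongr
    linarith
  refine (binProb_mono hp0 hp1 hsub).trans ((binProb_or_le hp0 hp1).trans ?_)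
  have := binProb_or_le (V := Icc 1 n) hp0 hp1 (P := HasStars (arithProgs k n) s₁ (r₁ + 1) ∅)
    (Q := HasStars (arithProgs k n) s₂ 1 ∅)
  linarith

/-- A large deviation without large excess at the vertices of large degree is unlikely. -/
lemma binProb_upperTail_and_heavyDegree_le (hk : 2 ≤ k) (hp0 : 0 < p) (hp1 : p ≤ 1)
    {s₀ : ℕ} (hs₀ : 0 < s₀) (ht : 0 < t) (hn : 2 * k ≤ n) :
    binProb (Icc 1 n) p (fun A =>
      #(arithProgs k n) * p ^ k + t ≤ #(edgesIn (arithProgs k n) A) ∧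
      heavyDegree (arithProgs k n) (Icc 1 n) A (2 * k ^ 3 * s₀) ≤ t / 2) ≤
      Real.exp (1 - t ^ 2 / (8 * k ^ 4 * s₀ * (4 * (#(arithProgs k n) * p ^ k) + t))) := by
  have hH := boundedCodegree_arithProgs (n := n) hk
  have hk0 : (0 : ℝ) < k := by exact_mod_cast (by omega : 0 < k)
  have hn0 : (0 : ℝ) < n := by exact_mod_cast (by omega : 0 < n)
  have hs₀' : (0 : ℝ) < s₀ := by exact_mod_cast hs₀
  have hμ0 : (0 : ℝ) < #(arithProgs k n) * p ^ k := by
    have h0 : 0 < (n : ℝ) ^ 2 * p ^ k := by positivity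
    exact pos_of_mul_pos_right (h0.trans_le (le_card_arithProgs_mul hk hn hp0.le)) (by positivity)
  -- M bounds the intersections in the sparse family, which keeps an excess of t/2: one quarter of t
  -- is spent on rM, the other makes the base μ/(μ + t/4).
  obtain ⟨M, hM⟩ : ∃ x : ℝ, x = k * (2 * k ^ 3 * s₀) := ⟨_, rfl⟩
  have hM0 : 0 < M := by rw [hM]; positivity
  obtain ⟨r, hr⟩ : ∃ r, r = ⌊t / (4 * M)⌋₊ := ⟨_, rfl⟩
  have hrl : (r : ℝ) * M ≤ t / 4 := by
    have : (r : ℝ) ≤ t / (4 * M) := by rw [hr]; exact Nat.floor_le (by positivity)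
    rw [le_div_iff₀ (by positivity)] at this
    linarith
  have hru : t / (4 * M) ≤ r + 1 := by rw [hr]; exact (Nat.lt_floor_add_one _).le
  have hsp := binProb_exists_sparse_le hH hp0.le hp1 r
    (b := #(arithProgs k n) * p ^ k + t / 4) (M := M) (by positivity) hM0.le
  generalize (#(arithProgs k n) * p ^ k : ℝ) = μ at hμ0 hsp ⊢
  refine le_trans (binProb_mono hp0.le hp1 ?_) (hsp.trans ?_)
  · rintro A - ⟨hA, hW⟩
    obtain ⟨J, hJ, hd, hc⟩ := exists_sparse_of_heavyDegree hH A (y := 2 * k ^ 3 * s₀)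
    rw [← hM] at hd
    exact ⟨J, hJ, hd, by linarith⟩
  · have h1 : μ / (μ + t / 4) ≤ Real.exp (-(t / (4 * μ + t))) := by
      have h2 := Real.add_one_le_exp (-(t / (4 * μ + t)))
      refine le_trans (le_of_eq ?_) h2
      field_simp
      ring
    refine (pow_le_pow_left₀ (by positivity) h1 r).trans ?_
    rw [← Real.exp_nat_mul, Real.exp_le_exp]
    -- Rounding r down therefore costs at most 1 in the exponent.
    have h3 : t / (4 * μ + t) ≤ 1 := by rw [div_le_one (by positivity)]; linarith
    have h4 : t ^ 2 / (8 * k ^ 4 * s₀ * (4 * μ + t)) = t / (4 * M) * (t / (4 * μ + t)) := by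
      rw [hM]; field_simp; norm_num
    have h5 : 0 ≤ t / (4 * μ + t) := by positivity
    rw [h4]
    have h6 := mul_le_mul_of_nonneg_right hru h5
    linarith

lemma half_le_floor {u : ℝ} (hu : 1 ≤ u) : u / 2 ≤ (⌊u⌋₊ : ℝ) := by
  have h1 := Nat.lt_floor_add_one u
  have h2 : (1 : ℝ) ≤ ⌊u⌋₊ := by exact_mod_cast (Nat.one_le_floor_iff u).2 hu
  linarith

/-- If `L` is at most `ε` times the rate, then `t / L` exceeds the typical degree by a power of
`1 / p`. -/
lemma mul_le_of_le_rate (hk : 3 ≤ k) (hn : 0 < n) (hp0 : 0 < p) (hp1 : p ≤ 1) (ht : 0 < t)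
    {L ε : ℝ} (hL0 : 0 ≤ L) (hε : 0 < ε) (hL1 : L * (n ^ 3 * p ^ (2 * k - 1)) ≤ ε * t ^ 2)
    (hL2 : L ≤ ε * (√t * Real.log (1 / p))) :
    n * p ^ (k - 1) * Real.exp (Real.log (1 / p) / 6) * L ≤ 3 * ε * t := by
  have hn0 : (0 : ℝ) < n := by exact_mod_cast hn
  have hlam0 : 0 ≤ Real.log (1 / p) := Real.log_nonneg (by rw [le_div_iff₀ hp0]; linarith)
  have hpl := exp_neg_log_one_div hp0
  generalize Real.log (1 / p) = lam at hlam0 hpl hL2 ⊢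
  have hV0 : 0 < (n : ℝ) ^ 3 * p ^ (2 * k - 1) := by positivity
  have h1 : (n * p ^ (k - 1) * Real.exp (lam / 6)) ^ 3 * lam ^ 2 ≤
      16 * (n ^ 3 * p ^ (2 * k - 1)) := by
    have h2 : Real.exp (lam / 6) ^ 3 * lam ^ 2 * p ≤ 16 := by
      have h3 := sq_mul_exp_neg_le lam (c := 1 / 2) (by norm_num) hlam0
      have h4 : Real.exp (lam / 6) ^ 3 * p = Real.exp (-(1 / 2 * lam)) := by
        rw [← hpl, ← Real.exp_nat_mul, ← Real.exp_add]
        congr 1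
        push_cast
        ring
      calc Real.exp (lam / 6) ^ 3 * lam ^ 2 * p = lam ^ 2 * (Real.exp (lam / 6) ^ 3 * p) := by ring
        _ ≤ 16 := by rw [h4]; exact h3.trans_eq (by norm_num)
    -- This is 3(k-1) ≥ 2k, equivalent to k ≥ 3. The extra p cancels the exponential and the
    -- logarithm.
    have h5 : (p ^ (k - 1)) ^ 3 ≤ p * p ^ (2 * k - 1) := by
      rw [← pow_mul, ← pow_succ']
      exact pow_le_pow_of_le_one hp0.le hp1 (by omega)
    calc (n * p ^ (k - 1) * Real.exp (lam / 6)) ^ 3 * lam ^ 2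
        = n ^ 3 * (Real.exp (lam / 6) ^ 3 * lam ^ 2) * (p ^ (k - 1)) ^ 3 := by ring
      _ ≤ n ^ 3 * (Real.exp (lam / 6) ^ 3 * lam ^ 2) * (p * p ^ (2 * k - 1)) := by gcongr
      _ = n ^ 3 * p ^ (2 * k - 1) * (Real.exp (lam / 6) ^ 3 * lam ^ 2 * p) := by ring
      _ ≤ n ^ 3 * p ^ (2 * k - 1) * 16 := by gcongr
      _ = _ := by ring
  have h6 : L ^ 2 ≤ ε ^ 2 * t * lam ^ 2 := by
    refine (pow_le_pow_left₀ hL0 hL2 2).trans_eq ?_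
    rw [mul_pow, mul_pow, Real.sq_sqrt ht.le]
    ring
  -- Interpolation: the logarithmic bound is used twice and the variance bound once.
  have h7 : L ^ 3 * (n ^ 3 * p ^ (2 * k - 1)) ≤ ε ^ 3 * t ^ 3 * lam ^ 2 := by
    calc L ^ 3 * (n ^ 3 * p ^ (2 * k - 1)) = L ^ 2 * (L * (n ^ 3 * p ^ (2 * k - 1))) := by ring
      _ ≤ (ε ^ 2 * t * lam ^ 2) * (ε * t ^ 2) := by gcongr
      _ = _ := by ring
  refine (pow_le_pow_iff_left₀ (by positivity) (by positivity) (show 3 ≠ 0 by norm_num)).1 ?_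
  refine le_of_mul_le_mul_right ?_ hV0
  generalize (n * p ^ (k - 1) * Real.exp (lam / 6) : ℝ) = N at *
  generalize ((n : ℝ) ^ 3 * p ^ (2 * k - 1) : ℝ) = V at *
  by_cases hN : 0 ≤ N
  · calc (N * L) ^ 3 * V = N ^ 3 * (L ^ 3 * V) := by ring
      _ ≤ N ^ 3 * (ε ^ 3 * t ^ 3 * lam ^ 2) := by gcongr
      _ = ε ^ 3 * t ^ 3 * (N ^ 3 * lam ^ 2) := by ring
      _ ≤ ε ^ 3 * t ^ 3 * (16 * V) := by gcongr
      _ = 16 * (ε ^ 3 * t ^ 3 * V) := by ring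
      _ ≤ 27 * (ε ^ 3 * t ^ 3 * V) := by gcongr; norm_num
      _ = _ := by ring
  · have h8 : N * L ≤ 0 := mul_nonpos_of_nonpos_of_nonneg (not_le.1 hN).le hL0
    have h9 : (N * L) ^ 3 ≤ 0 := by
      rw [pow_succ]; exact mul_nonpos_of_nonneg_of_nonpos (sq_nonneg _) h8
    refine (mul_nonpos_of_nonpos_of_nonneg h9 hV0.le).trans (by positivity)

/-- With β = λ/12, the factor e^{2β} required of s₁ and s₂ is exactly the e^{λ/6} supplied by
`mul_le_of_le_rate`. Both are taken as large as the constraints involving t permit. -/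
lemma binProb_heavyDegree_le_of_rate (hk : 3 ≤ k) (hγ0 : 0 < γ) (hγ1 : γ < 1) (hn : 2 * k ≤ n)
    (hp0 : 0 < p) (hpγ : p ≤ 1 - γ) (hnp : 1 ≤ n * p ^ (k - 1))
    (hlog : Real.log n ≤ n * p ^ (k - 1)) (ht : 0 < t) {L ε : ℝ} (hL0 : 0 < L)
    (hε : ε * (30000 * k ^ 7) = γ ^ 2)
    (hL1 : L * (n ^ 3 * p ^ (2 * k - 1)) ≤ ε * t ^ 2)
    (hL2 : L ≤ ε * (√t * Real.log (1 / p))) {s₀ : ℕ} (hs₀ : 27 * k * (n * p ^ (k - 1)) ≤ s₀) :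
    binProb (Icc 1 n) p (fun A =>
      t / 2 < heavyDegree (arithProgs k n) (Icc 1 n) A (2 * k ^ 3 * s₀)) ≤
      3 * Real.exp (-L) := by
  have hp1 : p ≤ 1 := by linarith
  have hn0 : 0 < n := by omega
  have hk1 : (1 : ℝ) ≤ k := by exact_mod_cast (by omega : 1 ≤ k)
  have hk3 : (3 : ℝ) ≤ k := by exact_mod_cast hk
  have hk0 : (0 : ℝ) < k := by linarith
  have hε0 : 0 < ε := by
    have : 0 < ε * (30000 * (k : ℝ) ^ 7) := by rw [hε]; positivity
    exact pos_of_mul_pos_left this (by positivity)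
  have hε1 : 96 * k ^ 3 * ε ≤ 1 := by
    have h1 : (k : ℝ) ^ 3 ≤ k ^ 7 := pow_le_pow_right₀ hk1 (by norm_num)
    nlinarith
  have hNL := mul_le_of_le_rate hk hn0 hp0 hp1 ht hL0.le hε0 hL1 hL2
  have hlamγ : γ ≤ Real.log (1 / p) := le_log_one_div hp0 hpγ
  generalize Real.log (1 / p) = lam at hNL hlamγ hL2
  have he3 : Real.exp 1 ≤ 3 := by linarith [Real.exp_one_lt_d9]
  obtain ⟨N, hN⟩ : ∃ x : ℝ, x = n * p ^ (k - 1) * Real.exp (lam / 6) := ⟨_, rfl⟩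
  rw [← hN] at hNL
  have hNe : N * Real.exp (-(2 * (lam / 12))) = n * p ^ (k - 1) := by
    rw [hN, mul_assoc, ← Real.exp_add, show lam / 6 + -(2 * (lam / 12)) = 0 by ring,
      Real.exp_zero, mul_one]
  obtain ⟨N₀, hN₀⟩ : ∃ x : ℝ, x = n * p ^ (k - 1) := ⟨_, rfl⟩
  rw [← hN₀] at hnp hlog hs₀ hN hNe
  have hN0 : N₀ ≤ N := by
    rw [hN]
    exact le_mul_of_one_le_right (by linarith) (Real.one_le_exp (by linarith))
  have hN1 : 1 ≤ N := hnp.trans hN0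
  have hkN : 1 ≤ k * N := one_le_mul_of_one_le_of_one_le hk1 hN1
  have hNL' : 10000 * k ^ 7 * (N * L) ≤ γ ^ 2 * t := by
    calc 10000 * k ^ 7 * (N * L) ≤ 10000 * k ^ 7 * (3 * ε * t) := by gcongr
      _ = ε * (30000 * k ^ 7) * t := by ring
      _ = _ := by rw [hε]
  have hu₁ : 625 * (k * N) ≤ γ * (t / (16 * k ^ 5 * L)) := by
    rw [← mul_div_assoc, le_div_iff₀ (by positivity)]
    calc 625 * (k * N) * (16 * k ^ 5 * L) = 10000 * k ^ 6 * (N * L) := by ring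
      _ ≤ 10000 * k ^ 7 * (N * L) := by
        gcongr
        norm_num
      _ ≤ γ ^ 2 * t := hNL'
      _ ≤ γ * t := by gcongr; nlinarith
  have hu₂ : 26 * (k * N) ≤ γ * (t * (lam / 12) / (32 * k ^ 6 * L)) := by
    rw [← mul_div_assoc, le_div_iff₀ (by positivity)]
    calc 26 * (k * N) * (32 * k ^ 6 * L) = 832 * k ^ 7 * (N * L) := by ring
      _ ≤ 10000 / 12 * k ^ 7 * (N * L) := by gcongr; norm_num
      _ = 10000 * k ^ 7 * (N * L) / 12 := by ring
      _ ≤ γ ^ 2 * t / 12 := by gcongr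
      _ = γ * (t * (γ / 12)) := by ring
      _ ≤ γ * (t * (lam / 12)) := by gcongr
  obtain ⟨u₁, hu₁'⟩ : ∃ x : ℝ, x = t / (16 * k ^ 5 * L) := ⟨_, rfl⟩
  obtain ⟨u₂, hu₂'⟩ : ∃ x : ℝ, x = t * (lam / 12) / (32 * k ^ 6 * L) := ⟨_, rfl⟩
  rw [← hu₁'] at hu₁
  rw [← hu₂'] at hu₂
  have hγs : ∀ s : ℝ, 0 ≤ s → γ * s ≤ s := fun s hs => mul_le_of_le_one_left hs hγ1.le
  have hu₁1 : 1 ≤ u₁ := by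
    have := hγs u₁ (by rw [hu₁']; positivity)
    linarith
  have hu₂1 : 1 ≤ u₂ := by
    have hlam0 : 0 < lam := by linarith
    have := hγs u₂ (by rw [hu₂']; positivity)
    linarith
  have hs₁l := half_le_floor hu₁1
  have hs₂l := half_le_floor hu₂1
  have hs₁u : (⌊u₁⌋₊ : ℝ) ≤ u₁ := Nat.floor_le (by linarith)
  have hs₂u : (⌊u₂⌋₊ : ℝ) ≤ u₂ := Nat.floor_le (by linarith)
  have hs₁p : 0 < ⌊u₁⌋₊ := (Nat.one_le_floor_iff u₁).2 hu₁1
  have hs₂p : 0 < ⌊u₂⌋₊ := (Nat.one_le_floor_iff u₂).2 hu₂1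
  -- A single star with s₂ petals already costs L: βu₂ is of order tβ²/L, so this reduces to L² =
  -- O(tλ²), the logarithmic half of the rate.
  have hL₂ : L ≤ lam / 12 * ⌊u₂⌋₊ := by
    have h1 : L ^ 2 * (64 * k ^ 6) ≤ t * (lam / 12) ^ 2 := by
      have h2 := pow_le_pow_left₀ hL0.le hL2 2
      rw [mul_pow, mul_pow, Real.sq_sqrt ht.le] at h2
      calc L ^ 2 * (64 * k ^ 6) ≤ (ε ^ 2 * (t * lam ^ 2)) * (64 * k ^ 6) := by gcongr
        _ = (96 * k ^ 3 * ε) ^ 2 * (t * (lam / 12) ^ 2) := by ring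
        _ ≤ 1 ^ 2 * (t * (lam / 12) ^ 2) := by gcongr
        _ = _ := by ring
    have h3 : L ≤ lam / 12 * (u₂ / 2) := by
      have h4 : lam / 12 * (u₂ / 2) = t * (lam / 12) ^ 2 / (64 * k ^ 6 * L) := by
        rw [hu₂']; field_simp; ring
      rw [h4, le_div_iff₀ (by positivity)]
      linarith
    exact h3.trans (mul_le_mul_of_nonneg_left hs₂l (by linarith))
  have hs₀N : N₀ ≤ s₀ := by
    refine le_trans ?_ hs₀
    have : 1 ≤ 27 * (k : ℝ) := by linarith
    exact le_mul_of_one_le_left (by linarith) this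
  have hgen : ∀ s : ℝ, 10 * (k * N) ≤ γ * s →
      Real.exp 1 * (k * N₀) ≤ s * Real.exp (-(2 * (lam / 12))) ∧
      Real.log n ≤ lam / 12 * s := by
    intro s hs
    have hs0 : 0 ≤ s := by
      have : 0 < γ * s := lt_of_lt_of_le (by positivity) hs
      exact (pos_of_mul_pos_right this hγ0.le).le
    constructor
    · have h1 : 3 * (k * N) ≤ s := by linarith [hγs s hs0]
      calc Real.exp 1 * (k * N₀) ≤ 3 * (k * N₀) := by gcongr
        _ = 3 * (k * N) * Real.exp (-(2 * (lam / 12))) := by rw [← hNe]; ring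
        _ ≤ _ := by gcongr
    · have h2 : 3 * N ≤ k * N := by gcongr
      have h3 : γ * s ≤ lam * s := by gcongr
      linarith
  have hγs₁ := mul_le_mul_of_nonneg_left hs₁l hγ0.le
  have hγs₂ := mul_le_mul_of_nonneg_left hs₂l hγ0.le
  rw [hN₀] at hgen
  refine binProb_heavyDegree_le (by omega) hn0 hp0.le hp1 (β := lam / 12) (by linarith) hL0 ht
    (s₁ := ⌊u₁⌋₊) (s₂ := ⌊u₂⌋₊) ?_ hs₁p hs₂p ?_ (hgen _ ?_).1 (hgen _ ?_).1
    (hlog.trans hs₀N) (hgen _ ?_).2 (hgen _ ?_).2 hL₂ ?_ ?_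
  · have : (0 : ℝ) < s₀ := by linarith
    exact_mod_cast this
  -- The 27 in the bound on s₀ is 3³ ≥ e·e², since β = 1 at this scale.
  · rw [← hN₀, Real.exp_neg, ← div_eq_mul_inv, le_div_iff₀ (Real.exp_pos _),
      show (2 * 1 : ℝ) = ((2 : ℕ) : ℝ) * 1 by norm_num, Real.exp_nat_mul]
    calc Real.exp 1 * (k * N₀) * Real.exp 1 ^ 2 = Real.exp 1 ^ 3 * (k * N₀) := by ring
      _ ≤ 3 ^ 3 * (k * N₀) := by gcongr
      _ = 27 * k * N₀ := by ring
      _ ≤ s₀ := hs₀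
  · linarith
  · linarith
  · linarith
  · linarith
  · calc 16 * (k : ℝ) ^ 5 * L * ⌊u₁⌋₊ ≤ 16 * k ^ 5 * L * u₁ := by gcongr
      _ = t := by rw [hu₁']; exact mul_div_cancel₀ _ (by positivity)
  · calc 32 * (k : ℝ) ^ 6 * L * ⌊u₂⌋₊ ≤ 32 * k ^ 6 * L * u₂ := by gcongr
      _ = t * (lam / 12) := by rw [hu₂']; exact mul_div_cancel₀ _ (by positivity)

/-- Either the heavy degrees exceed t/2 (at most 3e^{-L}) or the sparse part carries the excess (at
most e·e^{-L}). -/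
lemma upperTail_le_six_mul_exp (hk : 3 ≤ k) (hγ0 : 0 < γ) (hγ1 : γ < 1) (hn : 2 * k ≤ n)
    (hp0 : 0 < p) (hpγ : p ≤ 1 - γ) (hnp : 1 ≤ n * p ^ (k - 1))
    (hlog : Real.log n ≤ n * p ^ (k - 1)) (ht : 0 < t) {L ε : ℝ} (hL0 : 0 < L)
    (hε : ε * (30000 * k ^ 7) = γ ^ 2)
    (hL1 : L * (n ^ 3 * p ^ (2 * k - 1)) ≤ ε * t ^ 2)
    (hL2 : L ≤ ε * (√t * Real.log (1 / p))) :
    binProb (Icc 1 n) p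
      (fun A => #(arithProgs k n) * p ^ k + t ≤ #(edgesIn (arithProgs k n) A)) ≤
      6 * Real.exp (-L) := by
  have hp1 : p ≤ 1 := by linarith
  have hn0 : 0 < n := by omega
  have hk1 : (1 : ℝ) ≤ k := by exact_mod_cast (by omega : 1 ≤ k)
  have hk0 : (0 : ℝ) < k := by linarith
  have hε0 : 0 < ε := by
    have : 0 < ε * (30000 * (k : ℝ) ^ 7) := by rw [hε]; positivity
    exact pos_of_mul_pos_left this (by positivity)
  obtain ⟨s₀, hs₀⟩ : ∃ s, s = ⌈27 * k * (n * p ^ (k - 1))⌉₊ := ⟨_, rfl⟩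
  have hs₀l : 27 * k * (n * p ^ (k - 1)) ≤ s₀ := hs₀ ▸ Nat.le_ceil _
  have hkN : 1 ≤ k * (n * p ^ (k - 1)) := one_le_mul_of_one_le_of_one_le hk1 hnp
  have hs₀u : (s₀ : ℝ) ≤ 28 * k * (n * p ^ (k - 1)) := by
    have := (Nat.ceil_lt_add_one (show 0 ≤ 27 * k * (n * p ^ (k - 1)) by positivity)).le
    rw [← hs₀] at this
    linarith
  have hs₀p : (0 : ℝ) < s₀ := by linarith
  have hA := binProb_heavyDegree_le_of_rate hk hγ0 hγ1 hn hp0 hpγ hnp hlog ht hL0 hε hL1 hL2 hs₀l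
  have hB := binProb_upperTail_and_heavyDegree_le (k := k) (n := n) (by omega) hp0 hp1
    (s₀ := s₀) (by exact_mod_cast hs₀p) ht hn
  have hE : L ≤ t ^ 2 / (8 * k ^ 4 * s₀ * (4 * (#(arithProgs k n) * p ^ k) + t)) := by
    have hNL := mul_le_of_le_rate hk hn0 hp0 hp1 ht hL0.le hε0 hL1 hL2
    have hlam0 : 0 ≤ Real.log (1 / p) := hγ0.le.trans (le_log_one_div hp0 hpγ)
    have h1 : n * p ^ (k - 1) * L ≤ 3 * ε * t := by
      refine le_trans (mul_le_mul_of_nonneg_right ?_ hL0.le) hNL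
      exact le_mul_of_one_le_right (by positivity) (Real.one_le_exp (by linarith))
    have hμ : #(arithProgs k n) * p ^ k ≤ n ^ 2 * p ^ k := by
      gcongr
      exact_mod_cast card_arithProgs_le (by omega)
    have h2 : n * p ^ (k - 1) * (n ^ 2 * p ^ k) = n ^ 3 * p ^ (2 * k - 1) := by
      rw [show 2 * k - 1 = (k - 1) + k by omega, pow_add]; ring
    have h3 : (k : ℝ) ^ 5 ≤ k ^ 7 := pow_le_pow_right₀ hk1 (by norm_num)
    have h4 : 1568 * k ^ 5 * ε ≤ 1 := by nlinarith
    rw [le_div_iff₀ (by positivity)]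
    calc L * (8 * k ^ 4 * s₀ * (4 * (#(arithProgs k n) * p ^ k) + t))
        ≤ L * (8 * k ^ 4 * (28 * k * (n * p ^ (k - 1))) * (4 * (n ^ 2 * p ^ k) + t)) := by gcongr
      _ = 896 * k ^ 5 * (L * (n * p ^ (k - 1) * (n ^ 2 * p ^ k))) +
          224 * k ^ 5 * (n * p ^ (k - 1) * L) * t := by ring
      _ ≤ 896 * k ^ 5 * (ε * t ^ 2) + 224 * k ^ 5 * (3 * ε * t) * t := by
        rw [h2]; gcongr
      _ = 1568 * k ^ 5 * ε * t ^ 2 := by ring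
      _ ≤ 1 * t ^ 2 := by gcongr
      _ = t ^ 2 := one_mul _
  have hB' := hB.trans (Real.exp_le_exp.2 (sub_le_sub_left hE 1))
  rw [sub_eq_add_neg, Real.exp_add] at hB'
  have he3 : Real.exp 1 * Real.exp (-L) ≤ 3 * Real.exp (-L) := by
    gcongr
    linarith [Real.exp_one_lt_d9]
  have hsplit := (binProb_mono (V := Icc 1 n) hp0.le hp1
    (P := fun A => #(arithProgs k n) * p ^ k + t ≤ #(edgesIn (arithProgs k n) A))
    (fun A _ hX => (le_or_gt (heavyDegree (arithProgs k n) (Icc 1 n) A (2 * k ^ 3 * s₀))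
      (t / 2)).imp (fun h => And.intro hX h) id)).trans (binProb_or_le hp0.le hp1)
  linarith

/-- Removes the prefactor 6 when the rate is bounded: if P > e^{-x}, then e^{-x} < 1/2 and 6e^{-4x}
≤ 6/16 < 1, a contradiction. -/
lemma le_exp_neg_of_le_half {P x : ℝ} (h1 : P ≤ 1 / 2) (h2 : P ≤ 6 * Real.exp (-(5 * x))) :
    P ≤ Real.exp (-x) := by
  by_contra hcon
  push Not at hcon
  have h3 : Real.exp (-x) < 1 / 2 := hcon.trans_le h1
  have h4 : Real.exp (-(5 * x)) = Real.exp (-x) ^ 4 * Real.exp (-x) := by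
    rw [← pow_succ, ← Real.exp_nat_mul]; congr 1; push_cast; ring
  have h5 : Real.exp (-x) ^ 4 ≤ (1 / 2) ^ 4 := pow_le_pow_left₀ (Real.exp_pos _).le h3.le 4
  have h6 := Real.exp_pos (-x)
  rw [h4] at h2
  nlinarith

/-- The upper bound for the upper tail. -/
lemma upperTail_upper_bound (hk : 3 ≤ k) (hγ0 : 0 < γ) (hγ1 : γ < 1) :
    ∃ c : ℝ, 0 < c ∧ ∀ (n : ℕ) (p t : ℝ), 2 * k ≤ n → 0 < p → p ≤ 1 - γ →
      1 ≤ n * p ^ (k - 1) → Real.log n ≤ n * p ^ (k - 1) → 0 < t → apVar k n p ≤ t ^ 2 →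
      binProb (Icc 1 n) p
          (fun A => #(arithProgs k n) * p ^ k + t ≤ #(edgesIn (arithProgs k n) A)) ≤
        Real.exp (-(c * min (t ^ 2 / apVar k n p) (√t * Real.log (1 / p)))) := by
  have hk1 : (1 : ℝ) ≤ k := by exact_mod_cast (by omega : 1 ≤ k)
  have hk0 : (0 : ℝ) < k := by linarith
  obtain ⟨ε, hε⟩ : ∃ x : ℝ, x = γ ^ 2 / (30000 * k ^ 7) := ⟨_, rfl⟩
  have hε0 : 0 < ε := by rw [hε]; positivity
  have hε' : ε * (30000 * k ^ 7) = γ ^ 2 := by rw [hε]; exact div_mul_cancel₀ _ (by positivity)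
  obtain ⟨a, ha⟩ : ∃ x : ℝ, x = γ / (256 * k) := ⟨_, rfl⟩
  have ha0 : 0 < a := by rw [ha]; positivity
  have ha' : a * (256 * k) = γ := by rw [ha]; exact div_mul_cancel₀ _ (by positivity)
  have ha1 : a ≤ 1 := by nlinarith
  -- The factor a replaces n³p^{2k-1} by the variance, and 5 is the loss in `le_exp_neg_of_le_half`.
  refine ⟨ε * a / 5, by positivity, ?_⟩
  intro n p t hn hp0 hpγ hnp hlog ht hvt
  have hp1 : p < 1 := by linarith
  have hW0 : 0 < apVar k n p := apVar_pos (by omega) hn hp0.le hp1 hnp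
  have hVW : a * (n ^ 3 * p ^ (2 * k - 1)) ≤ apVar k n p := by
    have h1 := le_apVar (k := k) (by omega) hn hp0.le hp1.le
    have h2 : n ^ 3 * p ^ (2 * k - 1) * γ ≤ n ^ 3 * p ^ (2 * k - 1) * (1 - p) := by
      gcongr; linarith
    have h3 : (256 * k) * (a * (n ^ 3 * p ^ (2 * k - 1))) ≤ (256 * k) * apVar k n p := by
      calc (256 * k) * (a * (n ^ 3 * p ^ (2 * k - 1)))
          = n ^ 3 * p ^ (2 * k - 1) * (a * (256 * k)) := by ring
        _ = n ^ 3 * p ^ (2 * k - 1) * γ := by rw [ha']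
        _ ≤ _ := h2.trans h1
    exact le_of_mul_le_mul_left h3 (by positivity)
  have hlam0 : 0 < Real.log (1 / p) := hγ0.trans_le (le_log_one_div hp0 hpγ)
  obtain ⟨R, hR⟩ : ∃ x : ℝ, x = min (t ^ 2 / apVar k n p) (√t * Real.log (1 / p)) := ⟨_, rfl⟩
  have hR0 : 0 < R := by
    rw [hR]
    exact lt_min (by positivity) (mul_pos (Real.sqrt_pos.2 ht) hlam0)
  have hR1 : R * apVar k n p ≤ t ^ 2 := by
    rw [← le_div_iff₀ hW0, hR]; exact min_le_left _ _
  have hR2 : R ≤ √t * Real.log (1 / p) := by rw [hR]; exact min_le_right _ _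
  rw [← hR]
  have hsix := upperTail_le_six_mul_exp hk hγ0 hγ1 hn hp0 hpγ hnp hlog ht
    (L := ε * a * R) (by positivity) hε' (by
      calc ε * a * R * (n ^ 3 * p ^ (2 * k - 1)) = ε * (R * (a * (n ^ 3 * p ^ (2 * k - 1)))) := by
            ring
        _ ≤ ε * (R * apVar k n p) := by gcongr
        _ ≤ ε * t ^ 2 := by gcongr) (by
      calc ε * a * R = ε * (a * R) := by ring
        _ ≤ ε * (1 * (√t * Real.log (1 / p))) := by gcongr
        _ = _ := by ring)
  have hhalf := binProb_add_le_half (V := Icc 1 n) (p := p)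
    (g := fun A => (#(edgesIn (arithProgs k n) A) : ℝ)) hp0.le hp1.le ht
    (binExp_card_edgesIn (boundedCodegree_arithProgs (by omega))) hvt
  exact le_exp_neg_of_le_half hhalf (hsix.trans_eq (by congr 3; ring))

end UpperBound

/-! ### Assembly of the two bounds -/

theorem mainTheorem5 (k : ℕ) (hk : 3 ≤ k) :
    ∃ n₀ : ℕ, 0 < n₀ ∧ ∀ γ : ℝ, 0 < γ → γ < 1 →
      ∃ c C : ℝ, 0 < c ∧ 0 < C ∧
        ∀ (n : ℕ) (p : unitInterval) (t : ℝ), n₀ ≤ n →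
          (Real.log (n : ℝ)) ^ (1 / ((k : ℝ) - 1)) * (n : ℝ) ^ (-(1 / ((k : ℝ) - 1))) ≤ (p : ℝ) →
          (p : ℝ) ≤ 1 - γ →
          √(arithProgVar k n p) ≤ t →
            (if arithProgMean k n p + t ≤ arithProgCount k n (Set.Icc 1 n) then (1 : ℝ) else 0) *
                Real.exp (-(C * arithProgRate k n p t)) ≤
              (randomSubset n p).real {S | arithProgMean k n p + t ≤ arithProgCount k n S} ∧
            (randomSubset n p).real {S | arithProgMean k n p + t ≤ arithProgCount k n S} ≤
              Real.exp (-(c * arithProgRate k n p t)) := by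
  refine ⟨2 * k, by omega, fun γ hγ0 hγ1 => ?_⟩
  obtain ⟨C, hC, hlower⟩ := upperTail_lower_bound hk hγ0 hγ1
  obtain ⟨c, hc, hupper⟩ := upperTail_upper_bound hk hγ0 hγ1
  refine ⟨c, C, hc, hC, ?_⟩
  intro n p t hn hp hpγ hvt
  have hn3 : (3 : ℝ) ≤ n := by exact_mod_cast (by omega : 3 ≤ n)
  have hn0 : (0 : ℝ) < n := by linarith
  have hlog1 : 1 ≤ Real.log n := by
    rw [Real.le_log_iff_exp_le hn0]
    linarith [Real.exp_one_lt_d9]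
  have hk1 : (0 : ℝ) < (k : ℝ) - 1 := by
    have : (3 : ℝ) ≤ k := by exact_mod_cast hk
    linarith
  have hp0 : (0 : ℝ) < p := lt_of_lt_of_le (by positivity) hp
  -- The hypothesis on p, raised to the power k-1. As log n ≥ 1, it also yields np^{k-1} ≥ 1.
  have hlog : Real.log n ≤ n * (p : ℝ) ^ (k - 1) := by
    have h1 := pow_le_pow_left₀ (by positivity) hp (k - 1)
    have hcast : ((k - 1 : ℕ) : ℝ) = (k : ℝ) - 1 := by
      rw [Nat.cast_sub (by omega), Nat.cast_one]
    rw [mul_pow, ← Real.rpow_natCast (Real.log n ^ _), ← Real.rpow_natCast ((n : ℝ) ^ _),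
      ← Real.rpow_mul (by linarith), ← Real.rpow_mul hn0.le, hcast,
      div_mul_cancel₀ _ hk1.ne', Real.rpow_one, neg_mul, div_mul_cancel₀ _ hk1.ne',
      Real.rpow_neg_one, ← div_eq_mul_inv, div_le_iff₀ hn0] at h1
    linarith
  have hnp := hlog1.trans hlog
  have hp1 : (p : ℝ) < 1 := by linarith
  have hW0 : 0 < apVar k n p := apVar_pos (by omega) hn hp0.le hp1 hnp
  rw [arithProgVar_eq (by omega)] at hvt
  have ht : 0 < t := (Real.sqrt_pos.2 hW0).trans_le hvt
  have hvt2 : apVar k n p ≤ t ^ 2 := (Real.sqrt_le_left ht.le).1 hvt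
  have hprob : (randomSubset n p).real {S | arithProgMean k n p + t ≤ arithProgCount k n S} =
      binProb (Finset.Icc 1 n) p (fun A => (arithProgs k n).card * (p : ℝ) ^ k + t ≤
        (edgesIn (arithProgs k n) A).card) := by
    rw [randomSubset, ← Finset.coe_Icc, setBernoulli_real_eq_binProb]
    simp_rw [arithProgCount_coe, arithProgMean_eq (show 2 ≤ k by omega)]
  rw [hprob, arithProgRate, arithProgVar_eq (by omega)]
  refine ⟨?_, hupper n p t hn hp0 hpγ hnp hlog ht hvt2⟩
  split_ifs with hmax
  · rw [one_mul]
    rw [← Finset.coe_Icc, arithProgCount_coe, edgesIn_arithProgs_Icc le_rfl,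
      arithProgMean_eq (by omega)] at hmax
    exact hlower n p t hn hp0 hpγ hnp ht hvt2 hmax
  · rw [zero_mul]
    exact binProb_nonneg hp0.le hp1.le
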